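/- Let $d\ge 0$ and let $X$ be a smooth (Hausdorff, $\sigma$-compact) manifold of dimension $1+d$. Let $P\to X$ be a principal $\mathrm{SO}(1,d)$-bundle, given by a trivializing open cover $\{U_i\}$ and smooth transition functions $\gamma_{ij}:U_i\cap U_j\to \mathrm{SO}(1,d)$, and let $e$ be a coframe, i.e. an isomorphism of vector bundles $e:TX\xrightarrow{\sim} P\times_{\mathrm{SO}(1,d)}\mathbb{R}^{1,d}$, with local representatives $e_i$, $e_j=\gamma_{ji}e_i$. Put $\eta=\mathrm{diag}(-1,1,\dots,1)$, let $g=\langle e,e\rangle=\eta_{ab}\,e^a\otimes e^b$, and let $(\widehat e_a)$ be the dual frame of $(e^a)$ over $U_i$. Round brackets denote symmetrization, $A_{(db)}=\tfrac12(A_{db}+A_{bd})$. A *Levi-Civita connection* $\omega^{\mathrm{LC}}$ of $e$ is an $\mathrm{SO}(1,d)$-connection (smooth $\mathfrak{so}(1,d)$-valued 1-forms $\omega_i$ on $U_i$ with $\omega_j=\gamma_{ji}\omega_i\gamma_{ij}+\gamma_{ji}\,\mathrm{d}\gamma_{ij}$) with vanishing torsion $\mathrm{d}^{\omega}e=\mathrm{d}e+\omega\wedge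 e=0$. A *covariant Lie derivative* is given on the coframe by $L_\xi e+B_\xi\cdot e$, where $\xi\mapsto (B_\xi)_i$ is a family of $\mathbb{R}$-linear maps from vector fields on $X$ to smooth $\mathfrak{so}(1,d)$-valued functions on $U_i$ with $(B_\xi)_j=\gamma_{ji}(B_\xi)_i\gamma_{ij}+\gamma_{ji}\,\iota_\xi \mathrm{d}\gamma_{ij}$ (equivalently, by an $\mathbb{R}$-linear lift of vector fields on $X$ to invariant vector fields on $P$). It is the *Kosmann Lie derivative* $L^K$ of $e$ if $L_\xi g=2\,\langle L^K_\xi e,e\rangle=2\,\eta_{ab}\,(L^K_\xi e)^a\otimes e^b$ for all vector fields $\xi$. The affine Levi-Civita connection $\nabla^{\mathrm{LC}}$ is the torsion-free connection on $TX$ compatible with $g$. Then $\omega^{\mathrm{LC}}$, $L^K$ and a smooth $\nabla^{\mathrm{LC}}$ exist, and for all such $\omega^{\mathrm{LC}}$, $L^K$ and $\nabla^{\mathrm{LC}}$: 1. $\nabla^{\mathrm{LC}}\xi=e^{-1}\big(\mathrm{d}^{\omega^{\mathrm{LC}}}e(\xi)\big)$, i.e. $\nabla^{\mathrm{LC}}_v\xi=e_i^{-1}\big(\mathrm{d}(e_i(\xi))(v)+\omega_i(v)\,e_i(\xi)\big)$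 at every point of every $U_i$ at which the vector field $\xi$ is differentiable and for every tangent vector $v$ there. 2. For every smooth vector field $\xi$ on $X$, $$L^K_\xi e=0\iff (\mathrm{d}^{\omega^{\mathrm{LC}}}\iota_\xi e)_{(db)}=0\iff \nabla^{\mathrm{LC}}_{(d}\,\xi_{b)}=0\iff L_\xi g=0,$$ where $(\mathrm{d}^{\omega^{\mathrm{LC}}}\iota_\xi e)_{db}=\eta_{da}\,(\mathrm{d}^{\omega^{\mathrm{LC}}}\iota_\xi e)^a(\widehat e_b)$ and $\nabla^{\mathrm{LC}}_d\xi_b=g(\nabla^{\mathrm{LC}}_{\widehat e_d}\xi,\widehat e_b)$; the second and third conditions are required over every $U_i$. The third condition is the Killing equation. -/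

import Mathlib

open scoped Manifold ContDiff Matrix
open Bundle

noncomputable section

namespace KosmannLie

/-! ### Linear algebra of Minkowski space -/

/-- The vector space `ℝ^{1,d}`; the index `0` is the time direction. -/
abbrev Mink (d : ℕ) : Type := Fin (d + 1) → ℝ

/-- Real square matrices acting on `ℝ^{1,d}`. -/
abbrev Mat (d : ℕ) : Type := Matrix (Fin (d + 1)) (Fin (d + 1)) ℝ

/-- The matrix `η = diag(-1, 1, …, 1)`. -/
def etaMat (d : ℕ) : Mat d := Matrix.diagonal (fun a => if a = 0 then -1 else 1)

/-- The Minkowski pairing `⟨u, v⟩ = η_{ab} u^a v^b`. -/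
def eta {d : ℕ} (u v : Mink d) : ℝ := u ⬝ᵥ (etaMat d *ᵥ v)

/-- The group `SO(1,d)`, as a set of matrices. -/
def SO (d : ℕ) : Set (Mat d) := {A | Aᵀ * etaMat d * A = etaMat d ∧ A.det = 1}

/-- The Lie algebra `𝔰𝔬(1,d)` of the matrices `A` with `Aᵀ η = -η A`. -/
def so (d : ℕ) : Submodule ℝ (Mat d) := skewAdjointMatricesSubmodule (etaMat d)

/-- The symmetrization `A_{(db)} = (A_{db} + A_{bd}) / 2`. -/
def symPart {d : ℕ} (A : Mat d) : Mat d := (1 / 2 : ℝ) • (A + Aᵀ)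

/-! ### Vector fields and forms -/

section Forms

variable {d : ℕ} {X : Type*} [TopologicalSpace X]
  [ChartedSpace (EuclideanSpace ℝ (Fin (d + 1))) X] [IsManifold (𝓡 (d + 1)) ∞ X]

/-- `V` is differentiable at the point `x`, as a section of the tangent bundle. -/
def VFDiffAt (V : ∀ x : X, TangentSpace (𝓡 (d + 1)) x) (x : X) : Prop :=
  MDifferentiableAt (𝓡 (d + 1)) ((𝓡 (d + 1)).prod 𝓘(ℝ, EuclideanSpace ℝ (Fin (d + 1))))
    (fun y => TotalSpace.mk' (EuclideanSpace ℝ (Fin (d + 1))) y (V y)) x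

/-- The differential of a function valued in a normed space. -/
def dFun {F : Type*} [NormedAddCommGroup F] [NormedSpace ℝ F] (f : X → F) (x : X) :
    TangentSpace (𝓡 (d + 1)) x →L[ℝ] F :=
  mvfderiv (𝓡 (d + 1)) f x

/-- The entrywise differential of a matrix-valued function, evaluated on a tangent vector. -/
def dMat (γ : X → Mat d) (x : X) (v : TangentSpace (𝓡 (d + 1)) x) : Mat d :=
  Matrix.of fun a b => dFun (fun y => γ y a b) x v

/-- The exterior derivative of a vector-valued 1-form, evaluated on two vector fields:
`dθ(V, W) = V(θ(W)) - W(θ(V)) - θ([V, W])`. -/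
def dForm {F : Type*} [NormedAddCommGroup F] [NormedSpace ℝ F]
    (θ : ∀ x : X, TangentSpace (𝓡 (d + 1)) x →L[ℝ] F)
    (V W : ∀ x : X, TangentSpace (𝓡 (d + 1)) x) (x : X) : F :=
  dFun (fun y => θ y (W y)) x (V x) - dFun (fun y => θ y (V y)) x (W x)
    - θ x (VectorField.mlieBracket (𝓡 (d + 1)) V W x)

/-- The (ordinary) Lie derivative `L_ξ θ = d ι_ξ θ + ι_ξ dθ` of a vector-valued 1-form,
evaluated on the vector field `V`. -/
def lieForm {F : Type*} [NormedAddCommGroup F] [NormedSpace ℝ F]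
    (ξ : ∀ x : X, TangentSpace (𝓡 (d + 1)) x)
    (θ : ∀ x : X, TangentSpace (𝓡 (d + 1)) x →L[ℝ] F)
    (V : ∀ x : X, TangentSpace (𝓡 (d + 1)) x) (x : X) : F :=
  dFun (fun y => θ y (ξ y)) x (V x) + dForm θ ξ V x

/-- `θ` is a smooth 1-form on the set `s`, with values in `F`. -/
def SmoothFormOn {F : Type*} [NormedAddCommGroup F] [NormedSpace ℝ F]
    (θ : ∀ x : X, TangentSpace (𝓡 (d + 1)) x →L[ℝ] F) (s : Set X) : Prop :=
  ContMDiffOn (𝓡 (d + 1)) ((𝓡 (d + 1)).prod 𝓘(ℝ, EuclideanSpace ℝ (Fin (d + 1)) →L[ℝ] F)) ∞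
    (fun x => (⟨x, θ x⟩ : TotalSpace (EuclideanSpace ℝ (Fin (d + 1)) →L[ℝ] F)
      (fun y : X => TangentSpace (𝓡 (d + 1)) y →L[ℝ] Bundle.Trivial X F y))) s

end Forms

/-- The real vector space of smooth vector fields on `X`. -/
abbrev VF (d : ℕ) (X : Type*) [TopologicalSpace X]
    [ChartedSpace (EuclideanSpace ℝ (Fin (d + 1))) X] [IsManifold (𝓡 (d + 1)) ∞ X] :=
  ContMDiffSection (𝓡 (d + 1)) (EuclideanSpace ℝ (Fin (d + 1))) ∞
    (TangentSpace (𝓡 (d + 1)) : X → Type _)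

/-! ### Lorentz structures, coframes and connections

As usual in gauge theory, bundles and fields are given by their local representatives over a
trivializing open cover `U i`. All local representatives are total functions on `X`, but only
their values on `U i` carry meaning. -/

/-- A principal `SO(1,d)`-bundle over `X`, through a trivializing open cover and smooth transition
functions `γ i j : U i ∩ U j → SO(1,d)`. -/
structure LorentzBundle (d : ℕ) (X : Type*) [TopologicalSpace X]
    [ChartedSpace (EuclideanSpace ℝ (Fin (d + 1))) X] (ι : Type*) where
  U : ι → Set X
  isOpen : ∀ i, IsOpen (U i)
  cover : ∀ x, ∃ i, x ∈ U i
  γ : ι → ι → X → Mat d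
  γ_mem : ∀ i j, ∀ x ∈ U i ∩ U j, γ i j x ∈ SO d
  γ_smooth : ∀ i j a b,
    ContMDiffOn (𝓡 (d + 1)) 𝓘(ℝ, ℝ) ∞ (fun x => γ i j x a b) (U i ∩ U j)
  γ_cocycle : ∀ i j k, ∀ x ∈ U i ∩ U j ∩ U k, γ i j x * γ j k x = γ i k x

section Fields

variable {d : ℕ} {X : Type*} [TopologicalSpace X]
  [ChartedSpace (EuclideanSpace ℝ (Fin (d + 1))) X] [IsManifold (𝓡 (d + 1)) ∞ X]
  {ι : Type*}

/-- A coframe: an isomorphism of vector bundles from `TX` to the bundle with fibre `ℝ^{1,d}`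
associated to `P`, i.e. a family of smooth 1-forms `e i` on `U i` that are pointwise linear
isomorphisms and satisfy `e_j = γ_{ji} e_i`. -/
structure Coframe (P : LorentzBundle d X ι) where
  form : ι → ∀ x : X, TangentSpace (𝓡 (d + 1)) x ≃L[ℝ] Mink d
  smooth : ∀ i, SmoothFormOn (fun x => (form i x : TangentSpace (𝓡 (d + 1)) x →L[ℝ] Mink d)) (P.U i)
  patch : ∀ i j, ∀ x ∈ P.U i ∩ P.U j, ∀ v : TangentSpace (𝓡 (d + 1)) x,
    form j x v = P.γ j i x *ᵥ form i x v

/-- An `SO(1,d)`-connection on `P`: a family of smooth `𝔰𝔬(1,d)`-valued 1-forms `ω i` on `U i`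
(with components `ω^a_b`) such that `ω_j = γ_{ji} ω_i γ_{ij} + γ_{ji} dγ_{ij}`. -/
structure LorentzConnection (P : LorentzBundle d X ι) where
  form : ι → Fin (d + 1) → Fin (d + 1) → ∀ x : X, TangentSpace (𝓡 (d + 1)) x →L[ℝ] ℝ
  smooth : ∀ i a b, SmoothFormOn (form i a b) (P.U i)
  mem : ∀ i, ∀ x ∈ P.U i, ∀ v : TangentSpace (𝓡 (d + 1)) x,
    Matrix.of (fun a b => form i a b x v) ∈ so d
  patch : ∀ i j, ∀ x ∈ P.U i ∩ P.U j, ∀ v : TangentSpace (𝓡 (d + 1)) x,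
    Matrix.of (fun a b => form j a b x v) =
      P.γ j i x * Matrix.of (fun a b => form i a b x v) * P.γ i j x
        + P.γ j i x * dMat (P.γ i j) x v

/-- A covariant Lie derivative for fields associated to `P`, through its correction terms: a family
of `ℝ`-linear maps `ξ ↦ B_ξ` from vector fields to smooth `𝔰𝔬(1,d)`-valued functions on `U i`
with `B_j = γ_{ji} B_i γ_{ij} + γ_{ji} ι_ξ dγ_{ij}`. Equivalently, this is an `ℝ`-linear lift of
vector fields on `X` to invariant vector fields on the total space of `P`. -/
structure CovariantLie (P : LorentzBundle d X ι) where
  B : ι → VF d X →ₗ[ℝ] (X → Mat d)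
  smooth : ∀ i ξ a b, ContMDiffOn (𝓡 (d + 1)) 𝓘(ℝ, ℝ) ∞ (fun x => B i ξ x a b) (P.U i)
  mem : ∀ i ξ, ∀ x ∈ P.U i, B i ξ x ∈ so d
  patch : ∀ i j ξ, ∀ x ∈ P.U i ∩ P.U j,
    B j ξ x = P.γ j i x * B i ξ x * P.γ i j x + P.γ j i x * dMat (P.γ i j) x (ξ x)

variable {P : LorentzBundle d X ι}

namespace Coframe

/-- The local representative `e i` as a 1-form. -/
def toForm (e : Coframe P) (i : ι) (x : X) : TangentSpace (𝓡 (d + 1)) x →L[ℝ] Mink d :=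
  (e.form i x : TangentSpace (𝓡 (d + 1)) x →L[ℝ] Mink d)

/-- The dual frame `ê_a` over `U i`. -/
def frame (e : Coframe P) (i : ι) (a : Fin (d + 1)) (x : X) : TangentSpace (𝓡 (d + 1)) x :=
  (e.form i x).symm (Pi.single a 1)

/-- The local representative over `U i` of the section `ι_ξ e = e(ξ)`. -/
def contract (e : Coframe P) (i : ι) (ξ : ∀ x : X, TangentSpace (𝓡 (d + 1)) x) (x : X) : Mink d :=
  e.form i x (ξ x)

/-- The metric `g = ⟨e, e⟩ = η_{ab} e^a ⊗ e^b`, computed with any local representative at `x`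
(see `metric_eq`). -/
def metric (e : Coframe P) (x : X) (v w : TangentSpace (𝓡 (d + 1)) x) : ℝ :=
  eta (e.form (P.cover x).choose x v) (e.form (P.cover x).choose x w)

/-- The metric does not depend on the local representative of the coframe. -/
theorem metric_eq (e : Coframe P) {i : ι} {x : X} (hx : x ∈ P.U i)
    (v w : TangentSpace (𝓡 (d + 1)) x) :
    e.metric x v w = eta (e.form i x v) (e.form i x w) := by
  have hj := (P.cover x).choose_spec
  unfold metric
  rw [e.patch i _ x ⟨hx, hj⟩ v, e.patch i _ x ⟨hx, hj⟩ w]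
  have h := (P.γ_mem (P.cover x).choose i x ⟨hj, hx⟩).1
  unfold eta
  rw [Matrix.dotProduct_mulVec, Matrix.vecMul_mulVec, ← Matrix.dotProduct_mulVec,
    Matrix.mulVec_mulVec, h]

/-- The Lie derivative `(L_ξ g)(V, W) = ξ(g(V, W)) - g([ξ, V], W) - g(V, [ξ, W])` of the metric. -/
def lieMetric (e : Coframe P) (ξ V W : ∀ x : X, TangentSpace (𝓡 (d + 1)) x) (x : X) : ℝ :=
  dFun (fun y => e.metric y (V y) (W y)) x (ξ x)
    - e.metric x (VectorField.mlieBracket (𝓡 (d + 1)) ξ V x) (W x)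
    - e.metric x (V x) (VectorField.mlieBracket (𝓡 (d + 1)) ξ W x)

/-- `L_ξ g = 0`. -/
def LieMetricVanishes (e : Coframe P) (ξ : VF d X) : Prop :=
  ∀ (x : X) (V W : ∀ x : X, TangentSpace (𝓡 (d + 1)) x), VFDiffAt V x → VFDiffAt W x →
    e.lieMetric ξ V W x = 0

end Coframe

namespace LorentzConnection

/-- The matrix `ω_i(v) ∈ 𝔰𝔬(1,d)`. -/
def eval (Ω : LorentzConnection P) (i : ι) (x : X) (v : TangentSpace (𝓡 (d + 1)) x) : Mat d :=
  Matrix.of fun a b => Ω.form i a b x v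

/-- The covariant derivative `(d^ω φ)(v) = dφ(v) + ω(v) φ` over `U i` of an `ℝ^{1,d}`-valued
0-form. -/
def dCov (Ω : LorentzConnection P) (i : ι) (φ : X → Mink d) (x : X)
    (v : TangentSpace (𝓡 (d + 1)) x) : Mink d :=
  dFun φ x v + Ω.eval i x v *ᵥ φ x

/-- The torsion `d^ω e = de + ω ∧ e` over `U i`, evaluated on two vector fields. -/
def torsion (Ω : LorentzConnection P) (e : Coframe P) (i : ι)
    (V W : ∀ x : X, TangentSpace (𝓡 (d + 1)) x) (x : X) : Mink d :=
  dForm (e.toForm i) V W x + Ω.eval i x (V x) *ᵥ e.form i x (W x)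
    - Ω.eval i x (W x) *ᵥ e.form i x (V x)

/-- `Ω` is the Levi-Civita connection of the coframe: the `SO(1,d)`-connection with
vanishing torsion `d^ω e = 0`. -/
def IsLeviCivita (Ω : LorentzConnection P) (e : Coframe P) : Prop :=
  ∀ i, ∀ x ∈ P.U i, ∀ V W : ∀ x : X, TangentSpace (𝓡 (d + 1)) x,
    VFDiffAt V x → VFDiffAt W x → Ω.torsion e i V W x = 0

/-- The components `(d^ω ι_ξ e)_{db}`, where `(d^ω ι_ξ e)_d = (d^ω ι_ξ e)_{db} e^b` and the index
`d` is lowered with `η`. -/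
def dCovComp (Ω : LorentzConnection P) (e : Coframe P) (i : ι)
    (ξ : ∀ x : X, TangentSpace (𝓡 (d + 1)) x) (x : X) : Mat d :=
  Matrix.of fun a b => eta (Pi.single a 1) (Ω.dCov i (e.contract i ξ) x (e.frame i b x))

end LorentzConnection

namespace CovariantLie

/-- The covariant Lie derivative `L_ξ e + B_ξ e` of the coframe over `U i`, evaluated on the vector
field `V`. -/
def onCoframe (K : CovariantLie P) (e : Coframe P) (i : ι) (ξ : VF d X)
    (V : ∀ x : X, TangentSpace (𝓡 (d + 1)) x) (x : X) : Mink d :=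
  lieForm ξ (e.toForm i) V x + K.B i ξ x *ᵥ e.form i x (V x)

/-- The defining condition `L_ξ g = 2 ⟨L^K_ξ e, e⟩ = 2 η_{ab} (L^K_ξ e)^a ⊗ e^b` of the Kosmann
Lie derivative. -/
def IsKosmann (K : CovariantLie P) (e : Coframe P) : Prop :=
  ∀ (ξ : VF d X) (i : ι), ∀ x ∈ P.U i, ∀ V W : ∀ x : X, TangentSpace (𝓡 (d + 1)) x,
    VFDiffAt V x → VFDiffAt W x →
      e.lieMetric ξ V W x = 2 * eta (K.onCoframe e i ξ V x) (e.form i x (W x))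

/-- The covariant Lie derivative of the coframe along `ξ` vanishes. -/
def VanishesOnCoframe (K : CovariantLie P) (e : Coframe P) (ξ : VF d X) : Prop :=
  ∀ i, ∀ x ∈ P.U i, ∀ V : ∀ x : X, TangentSpace (𝓡 (d + 1)) x, VFDiffAt V x →
    K.onCoframe e i ξ V x = 0

end CovariantLie

/-- Affine connections on `X`, i.e. covariant derivatives on the tangent bundle. -/
abbrev AffineConnection (d : ℕ) (X : Type*) [TopologicalSpace X]
    [ChartedSpace (EuclideanSpace ℝ (Fin (d + 1))) X] [IsManifold (𝓡 (d + 1)) ∞ X] :=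
  CovariantDerivative (𝓡 (d + 1)) (EuclideanSpace ℝ (Fin (d + 1)))
    (TangentSpace (𝓡 (d + 1)) : X → Type _)

/-- `∇` is the Levi-Civita connection of the metric `g = ⟨e, e⟩`: it is torsion-free and
`d(g(V, W)) = g(∇V, W) + g(V, ∇W)`. -/
def IsAffineLeviCivita (D : AffineConnection d X) (e : Coframe P) : Prop :=
  D.torsion = 0 ∧
    ∀ (x : X) (V W : ∀ x : X, TangentSpace (𝓡 (d + 1)) x), VFDiffAt V x → VFDiffAt W x →
      ∀ v : TangentSpace (𝓡 (d + 1)) x,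
        dFun (fun y => e.metric y (V y) (W y)) x v =
          e.metric x (D V x v) (W x) + e.metric x (V x) (D W x v)

/-- The components `∇_d ξ_b = g(∇_{ê_d} ξ, ê_b)` over `U i`. -/
def nablaComp (D : AffineConnection d X) (e : Coframe P) (i : ι)
    (ξ : ∀ x : X, TangentSpace (𝓡 (d + 1)) x) (x : X) : Mat d :=
  Matrix.of fun a b => e.metric x (D ξ x (e.frame i a x)) (e.frame i b x)

end Fields

end KosmannLie

end

open KosmannLie

/-! Everything rests on a pointwise form of the uniqueness of the Levi-Civita connection.
`LeviCivitaAt e x N` says that an operation `N` on vector fields is torsion-free and metric at the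
single point `x`; by `LeviCivitaAt.unique` this determines `N` on fields differentiable at `x`. A
torsion-free `ω` makes `e⁻¹ ∘ d^ω ∘ e` such an operation (`Coframe.leviCivitaAt_covAt`), and so does
`∇`, so the two agree: this is claim 1.

The same uniqueness glues local data. On each `U i` the connection form is written down from the
structure coefficients of the frame; comparing the operations of two gauges on one frame field
yields the transformation law. It also shows that the affine connection, defined with a gauge chosen
point by point, is smooth.

With vanishing torsion, `L_ξ e = ∇ξ - ω(ξ) e` in frame components. Hence `B_ξ = ω(ξ) - (∇ξ)_{𝔰𝔬}`
leaves exactly the `η`-self-adjoint part of `∇ξ`, which is half of `L_ξ g`; this gives a Kosmann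
derivative. In claim 2, nondegeneracy of `η` links `L^K_ξ e = 0` to `L_ξ g = 0`, while
`lieMetric_eq` links `L_ξ g` to the symmetrized `∇ξ`, which claim 1 identifies with the symmetrized
`d^ω ι_ξ e`. -/

noncomputable section

namespace KosmannLie

/-! ### Smooth families of continuous linear maps. -/

section NormedTarget

variable {d : ℕ} {X : Type*} [TopologicalSpace X]
  [ChartedSpace (EuclideanSpace ℝ (Fin (d + 1))) X]

set_option synthInstance.maxHeartbeats 200000 in
theorem contMDiffAt_clm_smulRight {G H : Type*} [NormedAddCommGroup G] [NormedSpace ℝ G]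
    [NormedAddCommGroup H] [NormedSpace ℝ H] {f : X → G →L[ℝ] ℝ} {g : X → H} {x : X}
    (hf : ContMDiffAt (𝓡 (d + 1)) 𝓘(ℝ, G →L[ℝ] ℝ) ∞ f x)
    (hg : ContMDiffAt (𝓡 (d + 1)) 𝓘(ℝ, H) ∞ g x) :
    ContMDiffAt (𝓡 (d + 1)) 𝓘(ℝ, G →L[ℝ] H) ∞ (fun y => (f y).smulRight (g y)) x :=
  ((ContinuousLinearMap.smulRightL ℝ G H).contMDiff.contMDiffAt.comp x hf).clm_apply hg

theorem contMDiffAt_clm_inverse_apply {G H : Type*} [NormedAddCommGroup G] [NormedSpace ℝ G]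
    [CompleteSpace G] [NormedAddCommGroup H] [NormedSpace ℝ H] {f : X → G →L[ℝ] H} {x : X}
    (hf : ContMDiffAt (𝓡 (d + 1)) 𝓘(ℝ, G →L[ℝ] H) ∞ f x) (φ : G ≃L[ℝ] H)
    (hφ : (φ : G →L[ℝ] H) = f x) (w : H) :
    ContMDiffAt (𝓡 (d + 1)) 𝓘(ℝ, G) ∞ (fun y => (f y).inverse w) x := by
  have h : ContMDiffAt 𝓘(ℝ, G →L[ℝ] H) 𝓘(ℝ, H →L[ℝ] G) ∞ ContinuousLinearMap.inverse (f x) :=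
    hφ ▸ (contDiffAt_map_inverse φ).contMDiffAt
  exact (h.comp x hf).clm_apply contMDiffAt_const

end NormedTarget

/-! ### Smooth vector fields, vector-valued 1-forms and frames. -/

section Smoothness

variable {d : ℕ} {X : Type*} [TopologicalSpace X]
  [ChartedSpace (EuclideanSpace ℝ (Fin (d + 1))) X] [IsManifold (𝓡 (d + 1)) ∞ X]
  {F : Type*} [NormedAddCommGroup F] [NormedSpace ℝ F]

/-- The vector field `V` is smooth at the point `x`. -/
def VFSmoothAt (V : ∀ x : X, TangentSpace (𝓡 (d + 1)) x) (x : X) : Prop :=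
  ContMDiffAt (𝓡 (d + 1)) ((𝓡 (d + 1)).prod 𝓘(ℝ, EuclideanSpace ℝ (Fin (d + 1)))) ∞
    (fun y => TotalSpace.mk' (EuclideanSpace ℝ (Fin (d + 1))) y (V y)) x

/-- The vector-valued 1-form `θ` is smooth at the point `x`. -/
def SmoothFormAt (θ : ∀ x : X, TangentSpace (𝓡 (d + 1)) x →L[ℝ] F) (x : X) : Prop :=
  ContMDiffAt (𝓡 (d + 1)) ((𝓡 (d + 1)).prod 𝓘(ℝ, EuclideanSpace ℝ (Fin (d + 1)) →L[ℝ] F)) ∞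
    (fun x => (⟨x, θ x⟩ : TotalSpace (EuclideanSpace ℝ (Fin (d + 1)) →L[ℝ] F)
      (fun y : X => TangentSpace (𝓡 (d + 1)) y →L[ℝ] Bundle.Trivial X F y))) x

theorem VFSmoothAt.vfDiffAt {V : ∀ x : X, TangentSpace (𝓡 (d + 1)) x} {x : X}
    (h : VFSmoothAt V x) : VFDiffAt V x :=
  ContMDiffAt.mdifferentiableAt h (by simp)

theorem smoothFormOn_iff {θ : ∀ x : X, TangentSpace (𝓡 (d + 1)) x →L[ℝ] F} {s : Set X}
    (hs : IsOpen s) : SmoothFormOn θ s ↔ ∀ x ∈ s, SmoothFormAt θ x :=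
  ⟨fun h x hx => (h x hx).contMDiffAt (hs.mem_nhds hx), fun h x hx => (h x hx).contMDiffWithinAt⟩

/-- The target bundle is trivial, so only the trivialization of the tangent bundle enters the
coordinate expression of `θ`. -/
theorem smoothFormAt_iff {θ : ∀ x : X, TangentSpace (𝓡 (d + 1)) x →L[ℝ] F} {x : X} :
    SmoothFormAt θ x ↔ ContMDiffAt (𝓡 (d + 1)) 𝓘(ℝ, EuclideanSpace ℝ (Fin (d + 1)) →L[ℝ] F) ∞
      (fun y => (θ y).comp ((trivializationAt (EuclideanSpace ℝ (Fin (d + 1)))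
        (TangentSpace (𝓡 (d + 1)) : X → Type _) x).symmL ℝ y)) x := by
  unfold SmoothFormAt
  rw [contMDiffAt_hom_bundle]
  refine ⟨fun h => h.2.congr_of_eventuallyEq ?_, fun h => ⟨contMDiffAt_id, ?_⟩⟩
  · refine Filter.Eventually.of_forall fun y => ?_
    ext v
    simp [ContinuousLinearMap.inCoordinates]
  · refine h.congr_of_eventuallyEq (Filter.Eventually.of_forall fun y => ?_)
    ext v
    simp [ContinuousLinearMap.inCoordinates]

theorem SmoothFormAt.apply {θ : ∀ x : X, TangentSpace (𝓡 (d + 1)) x →L[ℝ] F} {x : X}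
    (hθ : SmoothFormAt θ x) {V : ∀ x : X, TangentSpace (𝓡 (d + 1)) x} (hV : VFSmoothAt V x) :
    ContMDiffAt (𝓡 (d + 1)) 𝓘(ℝ, F) ∞ (fun y => θ y (V y)) x := by
  have h := ContMDiffAt.clm_bundle_apply (E₂ := Bundle.Trivial X F) (b := id) hθ hV
  exact (contMDiffAt_section x).1 h

theorem SmoothFormAt.mdifferentiableAt_apply
    {θ : ∀ x : X, TangentSpace (𝓡 (d + 1)) x →L[ℝ] F} {x : X}
    (hθ : SmoothFormAt θ x) {V : ∀ x : X, TangentSpace (𝓡 (d + 1)) x} (hV : VFDiffAt V x) :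
    MDifferentiableAt (𝓡 (d + 1)) 𝓘(ℝ, F) (fun y => θ y (V y)) x := by
  have h := MDifferentiableAt.clm_bundle_apply (E₂ := Bundle.Trivial X F) (b := id)
    (ContMDiffAt.mdifferentiableAt hθ (by simp)) hV
  exact (mdifferentiableAt_section _ _).1 h

theorem SmoothFormAt.clm_comp {G : Type*} [NormedAddCommGroup G] [NormedSpace ℝ G]
    {θ : ∀ x : X, TangentSpace (𝓡 (d + 1)) x →L[ℝ] F} {x : X}
    (hθ : SmoothFormAt θ x) (L : F →L[ℝ] G) : SmoothFormAt (fun y => L.comp (θ y)) x := by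
  rw [smoothFormAt_iff] at hθ ⊢
  exact (contMDiffAt_const (c := L)).clm_comp hθ

theorem SmoothFormAt.smul {θ : ∀ x : X, TangentSpace (𝓡 (d + 1)) x →L[ℝ] F} {x : X}
    {f : X → ℝ} (hf : ContMDiffAt (𝓡 (d + 1)) 𝓘(ℝ, ℝ) ∞ f x) (hθ : SmoothFormAt θ x) :
    SmoothFormAt (fun y => f y • θ y) x :=
  ContMDiffAt.smul_section (s := θ) hf hθ

theorem SmoothFormAt.add {θ θ' : ∀ x : X, TangentSpace (𝓡 (d + 1)) x →L[ℝ] F} {x : X}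
    (hθ : SmoothFormAt θ x) (hθ' : SmoothFormAt θ' x) : SmoothFormAt (fun y => θ y + θ' y) x :=
  ContMDiffAt.add_section (s := θ) (t := θ') hθ hθ'

theorem SmoothFormAt.sum {κ : Type*} {s : Finset κ}
    {θ : κ → ∀ x : X, TangentSpace (𝓡 (d + 1)) x →L[ℝ] F} {x : X}
    (hθ : ∀ k ∈ s, SmoothFormAt (θ k) x) : SmoothFormAt (fun y => ∑ k ∈ s, θ k y) x :=
  ContMDiffAt.sum_section (t := θ) hθ

theorem smoothFormAt_dFun {f : X → F} {x : X} (hf : ContMDiffAt (𝓡 (d + 1)) 𝓘(ℝ, F) ∞ f x) :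
    SmoothFormAt (d := d) (dFun f) x := by
  rw [smoothFormAt_iff]
  have h := ContMDiffAt.mfderiv_const (m := ∞) hf (by simp)
  refine h.congr_of_eventuallyEq (Filter.Eventually.of_forall fun y => ?_)
  ext1 v
  simp only [ContinuousLinearMap.comp_apply, inTangentCoordinates,
    ContinuousLinearMap.inCoordinates, dFun, mvfderiv,
    TangentBundle.continuousLinearMapAt_model_space]
  rfl

/-- The covariant derivative of a field is a finite sum of such products of a form and a frame
vector; this lemma supplies its smoothness. -/
theorem smooth_smulRight {θ : ∀ x : X, TangentSpace (𝓡 (d + 1)) x →L[ℝ] ℝ} {x : X}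
    (hθ : SmoothFormAt θ x) {V : ∀ x : X, TangentSpace (𝓡 (d + 1)) x} (hV : VFSmoothAt V x) :
    ContMDiffAt (𝓡 (d + 1)) ((𝓡 (d + 1)).prod 𝓘(ℝ, EuclideanSpace ℝ (Fin (d + 1)) →L[ℝ]
        EuclideanSpace ℝ (Fin (d + 1)))) ∞
      (fun y => (⟨y, (θ y).smulRight (V y)⟩ : TotalSpace (EuclideanSpace ℝ (Fin (d + 1)) →L[ℝ]
        EuclideanSpace ℝ (Fin (d + 1))) (fun y : X => TangentSpace (𝓡 (d + 1)) y →L[ℝ]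
          TangentSpace (𝓡 (d + 1)) y))) x := by
  rw [smoothFormAt_iff] at hθ
  have hV' := (contMDiffAt_section x).1 hV
  rw [contMDiffAt_hom_bundle]
  refine ⟨contMDiffAt_id, ?_⟩
  refine (contMDiffAt_clm_smulRight hθ hV').congr_of_eventuallyEq ?_
  filter_upwards [(trivializationAt (EuclideanSpace ℝ (Fin (d + 1)))
        (TangentSpace (𝓡 (d + 1)) : X → Type _) x).open_baseSet.mem_nhds
        (FiberBundle.mem_baseSet_trivializationAt' x)] with y hy
  have hy' : y ∈ (chartAt (EuclideanSpace ℝ (Fin (d + 1))) x).source := by simpa using hy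
  ext1 v
  simp [ContinuousLinearMap.inCoordinates,
    Bundle.Trivialization.continuousLinearMapAt_apply, Bundle.Trivialization.linearMapAt_apply, hy']

variable {ι : Type*} {P : LorentzBundle d X ι}

theorem Coframe.smoothFormAt (e : Coframe P) {i : ι} {x : X} (hx : x ∈ P.U i) :
    SmoothFormAt (e.toForm i) x :=
  (smoothFormOn_iff (P.isOpen i)).1 (e.smooth i) x hx

/-- In a trivialization the frame is the inverse of the coframe applied to a constant vector, and
inversion is smooth near an invertible map. -/
theorem Coframe.vfSmoothAt_frame (e : Coframe P) {i : ι} {x : X} (hx : x ∈ P.U i)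
    (a : Fin (d + 1)) : VFSmoothAt (e.frame i a) x := by
  have hA := smoothFormAt_iff.1 (e.smoothFormAt hx)
  refine (contMDiffAt_section (s := e.frame i a) x).2 ?_
  set t := trivializationAt (EuclideanSpace ℝ (Fin (d + 1)))
        (TangentSpace (𝓡 (d + 1)) : X → Type _) x with ht
  have hmem : x ∈ t.baseSet := FiberBundle.mem_baseSet_trivializationAt' x
  have key : ∀ y (hy : y ∈ t.baseSet),
      (((t.continuousLinearEquivAt ℝ y hy).symm.trans (e.form i y) :
        EuclideanSpace ℝ (Fin (d + 1)) ≃L[ℝ] Mink d) :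
        EuclideanSpace ℝ (Fin (d + 1)) →L[ℝ] Mink d) =
      (e.toForm i y).comp (t.symmL ℝ y) := by
    intro y hy
    ext1 v
    simp [Coframe.toForm, t.symmL_apply hy]
  refine (contMDiffAt_clm_inverse_apply hA _ (key x hmem)
    (Pi.single a 1)).congr_of_eventuallyEq ?_
  filter_upwards [t.open_baseSet.mem_nhds hmem] with y hy
  rw [← key y hy, ContinuousLinearMap.inverse_equiv]
  simp [Coframe.frame, Bundle.Trivialization.continuousLinearEquivAt_apply]

end Smoothness

/-! ### The Minkowski pairing and its Lie algebra. -/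

section LinearAlgebra

variable {d : ℕ}

/-- The diagonal entries of `η`. -/
def etaSign (a : Fin (d + 1)) : ℝ := if a = 0 then -1 else 1

theorem etaSign_mul_self (a : Fin (d + 1)) : etaSign a * etaSign a = 1 := by
  unfold etaSign; split_ifs <;> norm_num

theorem etaMat_eq : etaMat d = Matrix.diagonal etaSign := rfl

theorem eta_eq_sum (u v : Mink d) : eta u v = ∑ a, etaSign a * u a * v a := by
  simp only [eta, etaMat_eq, dotProduct, Matrix.mulVec_diagonal]
  exact Finset.sum_congr rfl fun a _ => by ring

theorem eta_comm (u v : Mink d) : eta u v = eta v u := by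
  simp only [eta_eq_sum]
  exact Finset.sum_congr rfl fun a _ => by ring

/-- The Minkowski pairing as a bilinear map. -/
def etaBilin (d : ℕ) : Mink d →ₗ[ℝ] Mink d →ₗ[ℝ] ℝ := Matrix.toLinearMap₂' ℝ (etaMat d)

theorem etaBilin_apply (u v : Mink d) : etaBilin d u v = eta u v := by
  simp [etaBilin, eta, Matrix.toLinearMap₂'_apply']

theorem eta_add_left (u u' v : Mink d) : eta (u + u') v = eta u v + eta u' v := by
  simp [← etaBilin_apply]

theorem eta_sub_left (u u' v : Mink d) : eta (u - u') v = eta u v - eta u' v := by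
  simp [← etaBilin_apply]

theorem eta_add_right (u v v' : Mink d) : eta u (v + v') = eta u v + eta u v' := by
  simp [← etaBilin_apply]

theorem eta_sub_right (u v v' : Mink d) : eta u (v - v') = eta u v - eta u v' := by
  simp [← etaBilin_apply]

theorem eta_single_left (a : Fin (d + 1)) (v : Mink d) :
    eta (Pi.single a 1) v = etaSign a * v a := by
  rw [eta_eq_sum, Finset.sum_eq_single a] <;> simp +contextual

theorem eq_zero_of_eta_eq_zero {u : Mink d} (h : ∀ v, eta u v = 0) : u = 0 := by
  ext a
  have h1 := h (Pi.single a 1)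
  rw [eta_comm, eta_single_left] at h1
  have h2 : etaSign a ≠ 0 := fun h0 => by simpa [h0] using etaSign_mul_self a
  simpa [h2] using h1

theorem mem_so_iff {A : Mat d} : A ∈ so d ↔ Aᵀ * etaMat d = etaMat d * (-A) := by
  unfold so
  rw [mem_skewAdjointMatricesSubmodule]
  rfl

/-- Lowering the first index with `η` turns membership in `𝔰𝔬(1,d)` into antisymmetry. -/
theorem mem_so_iff_apply {A : Mat d} :
    A ∈ so d ↔ ∀ a b, etaSign a * A a b = - (etaSign b * A b a) := by
  rw [mem_so_iff, etaMat_eq, ← Matrix.ext_iff]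
  simp only [Matrix.mul_diagonal, Matrix.diagonal_mul, Matrix.transpose_apply, Matrix.neg_apply]
  refine ⟨fun h a b => ?_, fun h a b => ?_⟩
  · linarith [h b a]
  · linarith [h b a]

theorem eta_mulVec_of_mem_so {A : Mat d} (hA : A ∈ so d) (u v : Mink d) :
    eta (A *ᵥ u) v = - eta u (A *ᵥ v) := by
  have h : (A *ᵥ u) ⬝ᵥ (etaMat d *ᵥ v) = u ⬝ᵥ (Aᵀ *ᵥ (etaMat d *ᵥ v)) := by
    rw [dotProduct_comm, Matrix.dotProduct_mulVec, ← Matrix.mulVec_transpose, dotProduct_comm]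
  unfold eta
  rw [h, Matrix.mulVec_mulVec, mem_so_iff.1 hA, mul_neg, Matrix.neg_mulVec, dotProduct_neg,
    Matrix.mulVec_mulVec]

end LinearAlgebra

/-! ### Differentials of vector-valued functions and the product rule. -/

section Calculus

variable {d : ℕ} {X : Type*} [TopologicalSpace X]
  [ChartedSpace (EuclideanSpace ℝ (Fin (d + 1))) X]
  {F : Type*} [NormedAddCommGroup F] [NormedSpace ℝ F]
  {G : Type*} [NormedAddCommGroup G] [NormedSpace ℝ G]
  {H : Type*} [NormedAddCommGroup H] [NormedSpace ℝ H]

theorem dFun_congr {f g : X → F} {x : X} (h : f =ᶠ[nhds x] g) :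
    dFun (d := d) f x = dFun (d := d) g x := by
  ext v
  exact DFunLike.congr_fun (h.mfderiv_eq (I := 𝓡 (d + 1)) (I' := 𝓘(ℝ, F))) v

theorem dFun_const (c : F) (x : X) : dFun (d := d) (fun _ : X => c) x = 0 := mvfderiv_const c

theorem dFun_add {f g : X → F} {x : X}
    (hf : MDifferentiableAt (𝓡 (d + 1)) 𝓘(ℝ, F) f x)
    (hg : MDifferentiableAt (𝓡 (d + 1)) 𝓘(ℝ, F) g x) (v : TangentSpace (𝓡 (d + 1)) x) :
    dFun (d := d) (fun y => f y + g y) x v = dFun f x v + dFun g x v := by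
  unfold dFun
  rw [mvfderiv_fun_add hf hg]
  rfl

/-- A single product rule, read off in the chart at `x`, that serves for scalar multiplication, for
a fixed linear map and for the Minkowski pairing. -/
theorem dFun_bilin (B : F →L[ℝ] G →L[ℝ] H) {f : X → F} {g : X → G} {x : X}
    (hf : MDifferentiableAt (𝓡 (d + 1)) 𝓘(ℝ, F) f x)
    (hg : MDifferentiableAt (𝓡 (d + 1)) 𝓘(ℝ, G) g x) (v : TangentSpace (𝓡 (d + 1)) x) :
    dFun (d := d) (fun y => B (f y) (g y)) x v =
      B (dFun f x v) (g x) + B (f x) (dFun g x v) := by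
  have hf' := (mdifferentiableAt_iff _ _).1 hf
  have hg' := (mdifferentiableAt_iff _ _).1 hg
  have hB := B.hasFDerivWithinAt_of_bilinear hf'.2.hasFDerivWithinAt hg'.2.hasFDerivWithinAt
  have hBd : MDifferentiableAt (𝓡 (d + 1)) 𝓘(ℝ, H) (fun y => B (f y) (g y)) x := by
    refine (mdifferentiableAt_iff _ _).2 ⟨?_, hB.differentiableWithinAt⟩
    exact B.continuous₂.continuousAt.comp (hf'.1.prodMk hg'.1)
  unfold dFun
  rw [hBd.mvfderiv, hf.mvfderiv, hg.mvfderiv]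
  have h := hB.fderivWithin ((𝓡 (d + 1)).uniqueDiffOn _ (by simp))
  have hfx : writtenInExtChartAt (𝓡 (d + 1)) 𝓘(ℝ, F) x f (extChartAt (𝓡 (d + 1)) x x) = f x := by
    simp only [writtenInExtChartAt, Function.comp_apply, extChartAt_to_inv]; rfl
  have hgx : writtenInExtChartAt (𝓡 (d + 1)) 𝓘(ℝ, G) x g (extChartAt (𝓡 (d + 1)) x x) = g x := by
    simp only [writtenInExtChartAt, Function.comp_apply, extChartAt_to_inv]; rfl
  rw [hfx, hgx] at h
  exact (DFunLike.congr_fun h v).trans (add_comm _ _)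

theorem dFun_clm (L : F →L[ℝ] G) {f : X → F} {x : X}
    (hf : MDifferentiableAt (𝓡 (d + 1)) 𝓘(ℝ, F) f x) (v : TangentSpace (𝓡 (d + 1)) x) :
    dFun (d := d) (fun y => L (f y)) x v = L (dFun f x v) := by
  have h := dFun_bilin (ContinuousLinearMap.apply ℝ G).flip
    (mdifferentiableAt_const (c := L)) hf v
  simpa [dFun_const] using h

theorem mdifferentiableAt_pi {κ : Type*} [Fintype κ] {f : X → κ → ℝ} {x : X}
    (hf : ∀ k, MDifferentiableAt (𝓡 (d + 1)) 𝓘(ℝ, ℝ) (fun y => f y k) x) :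
    MDifferentiableAt (𝓡 (d + 1)) 𝓘(ℝ, κ → ℝ) f x := by
  rw [mdifferentiableAt_iff]
  refine ⟨continuousAt_pi.2 fun k => (hf k).continuousAt, differentiableWithinAt_pi.2 fun k => ?_⟩
  exact ((mdifferentiableAt_iff _ _).1 (hf k)).2

theorem dFun_apply {κ : Type*} [Fintype κ] {f : X → κ → ℝ} {x : X}
    (hf : MDifferentiableAt (𝓡 (d + 1)) 𝓘(ℝ, κ → ℝ) f x) (v : TangentSpace (𝓡 (d + 1)) x)
    (k : κ) : dFun (d := d) (fun y => f y k) x v = dFun f x v k :=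
  dFun_clm (ContinuousLinearMap.proj k) hf v

theorem dFun_eta {f g : X → Mink d} {x : X}
    (hf : MDifferentiableAt (𝓡 (d + 1)) 𝓘(ℝ, Mink d) f x)
    (hg : MDifferentiableAt (𝓡 (d + 1)) 𝓘(ℝ, Mink d) g x) (v : TangentSpace (𝓡 (d + 1)) x) :
    dFun (d := d) (fun y => eta (f y) (g y)) x v =
      eta (dFun f x v) (g x) + eta (f x) (dFun g x v) := by
  have h := dFun_bilin (LinearMap.toContinuousBilinearMap (etaBilin d)) hf hg v
  simpa [etaBilin_apply] using h

end Calculus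

/-! ### Pointwise uniqueness of the Levi-Civita connection; Killing fields. -/

section LeviCivita

variable {d : ℕ} {X : Type*} [TopologicalSpace X]
  [ChartedSpace (EuclideanSpace ℝ (Fin (d + 1))) X] [IsManifold (𝓡 (d + 1)) ∞ X]
  {ι : Type*} {P : LorentzBundle d X ι}

theorem exists_vfSmoothAt_eq {x : X} (v : TangentSpace (𝓡 (d + 1)) x) :
    ∃ V : ∀ x : X, TangentSpace (𝓡 (d + 1)) x, VFSmoothAt V x ∧ V x = v :=
  ⟨FiberBundle.extend (EuclideanSpace ℝ (Fin (d + 1))) v,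
    FiberBundle.contMDiffAt_extend _ _ v, by simp⟩

namespace Coframe

variable (e : Coframe P)

theorem metric_comm (x : X) (v w : TangentSpace (𝓡 (d + 1)) x) :
    e.metric x v w = e.metric x w v := eta_comm _ _

theorem metric_sub_left (x : X) (v v' w : TangentSpace (𝓡 (d + 1)) x) :
    e.metric x (v - v') w = e.metric x v w - e.metric x v' w := by
  simp [metric, eta_sub_left]

theorem metric_sub_right (x : X) (v w w' : TangentSpace (𝓡 (d + 1)) x) :
    e.metric x v (w - w') = e.metric x v w - e.metric x v w' := by
  simp [metric, eta_sub_right]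

theorem eq_zero_of_metric_eq_zero {x : X} {v : TangentSpace (𝓡 (d + 1)) x}
    (h : ∀ w, e.metric x v w = 0) : v = 0 := by
  have hv : e.form (P.cover x).choose x v = 0 := by
    refine eq_zero_of_eta_eq_zero fun u => ?_
    simpa [metric] using h ((e.form (P.cover x).choose x).symm u)
  simpa using hv

theorem mdifferentiableAt_contract {i : ι} {x : X} (hx : x ∈ P.U i)
    {V : ∀ x : X, TangentSpace (𝓡 (d + 1)) x} (hV : VFDiffAt V x) :
    MDifferentiableAt (𝓡 (d + 1)) 𝓘(ℝ, Mink d) (e.contract i V) x :=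
  (e.smoothFormAt hx).mdifferentiableAt_apply hV

theorem contMDiffAt_contract {i : ι} {x : X} (hx : x ∈ P.U i)
    {V : ∀ x : X, TangentSpace (𝓡 (d + 1)) x} (hV : VFSmoothAt V x) :
    ContMDiffAt (𝓡 (d + 1)) 𝓘(ℝ, Mink d) ∞ (e.contract i V) x :=
  (e.smoothFormAt hx).apply hV

theorem dFun_metric {i : ι} {x : X} (hx : x ∈ P.U i)
    {V W : ∀ x : X, TangentSpace (𝓡 (d + 1)) x} (hV : VFDiffAt V x) (hW : VFDiffAt W x)
    (v : TangentSpace (𝓡 (d + 1)) x) :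
    dFun (fun y => e.metric y (V y) (W y)) x v =
      eta (dFun (e.contract i V) x v) (e.form i x (W x)) +
        eta (e.form i x (V x)) (dFun (e.contract i W) x v) := by
  refine Eq.trans ?_ (dFun_eta (e.mdifferentiableAt_contract hx hV)
    (e.mdifferentiableAt_contract hx hW) v)
  refine DFunLike.congr_fun (dFun_congr ?_) v
  filter_upwards [(P.isOpen i).mem_nhds hx] with y hy
  exact e.metric_eq hy _ _

end Coframe

/-- The operation `N V v = ∇_v V` on vector fields is torsion-free and compatible with the
metric at the point `x`. -/
def LeviCivitaAt (e : Coframe P) (x : X)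
    (N : (∀ x : X, TangentSpace (𝓡 (d + 1)) x) → TangentSpace (𝓡 (d + 1)) x →
      TangentSpace (𝓡 (d + 1)) x) : Prop :=
  (∀ V W : ∀ x : X, TangentSpace (𝓡 (d + 1)) x, VFDiffAt V x → VFDiffAt W x →
    N W (V x) - N V (W x) = VectorField.mlieBracket (𝓡 (d + 1)) V W x) ∧
  ∀ V W : ∀ x : X, TangentSpace (𝓡 (d + 1)) x, VFDiffAt V x → VFDiffAt W x → ∀ v,
    dFun (fun y => e.metric y (V y) (W y)) x v = e.metric x (N V v) (W x) + e.metric x (V x) (N W v)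

/-- The difference `S(A,B,C) = g(N_B A - N'_B A, C)` is symmetric in `A, B` because the torsions
agree, and skew in `A, C` because both operations are metric. These two symmetries force `S = 0`. No
linearity of `N` is needed, since the vectors are extended to fields first. -/
theorem LeviCivitaAt.unique {e : Coframe P} {x : X}
    {N N' : (∀ x : X, TangentSpace (𝓡 (d + 1)) x) → TangentSpace (𝓡 (d + 1)) x →
      TangentSpace (𝓡 (d + 1)) x} (h : LeviCivitaAt e x N) (h' : LeviCivitaAt e x N')
    {V : ∀ x : X, TangentSpace (𝓡 (d + 1)) x} (hV : VFDiffAt V x)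
    (v : TangentSpace (𝓡 (d + 1)) x) : N V v = N' V v := by
  rw [← sub_eq_zero]
  refine e.eq_zero_of_metric_eq_zero fun w => ?_
  obtain ⟨W, hW, rfl⟩ := exists_vfSmoothAt_eq v
  obtain ⟨Z, hZ, rfl⟩ := exists_vfSmoothAt_eq w
  replace hW := hW.vfDiffAt
  replace hZ := hZ.vfDiffAt
  have sym : ∀ {A B C : ∀ x : X, TangentSpace (𝓡 (d + 1)) x}, VFDiffAt A x → VFDiffAt B x →
      e.metric x (N A (B x) - N' A (B x)) (C x) = e.metric x (N B (A x) - N' B (A x)) (C x) := by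
    intro A B C hA hB
    congr 1
    have h1 := (h.1 A B hA hB).trans (h'.1 A B hA hB).symm
    rw [sub_eq_sub_iff_add_eq_add] at h1 ⊢
    exact (add_comm _ _).trans h1.symm
  have skew : ∀ {A B C : ∀ x : X, TangentSpace (𝓡 (d + 1)) x}, VFDiffAt A x → VFDiffAt C x →
      e.metric x (N A (B x) - N' A (B x)) (C x) = - e.metric x (N C (B x) - N' C (B x)) (A x) := by
    intro A B C hA hC
    have h1 := (h.2 A C hA hC (B x)).symm.trans (h'.2 A C hA hC (B x))
    rw [e.metric_sub_left, e.metric_sub_left, e.metric_comm x (N C (B x)),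
      e.metric_comm x (N' C (B x))]
    linarith
  -- Alternating the two transpositions six times returns to the initial arguments with three sign
  -- changes, so `S = -S`.
  have h1 := sym (C := Z) hV hW
  have h2 := skew (B := V) hW hZ
  have h3 := sym (C := W) hZ hV
  have h4 := skew (B := Z) hV hW
  have h5 := sym (C := V) hW hZ
  have h6 := skew (B := W) hZ hV
  linarith

/-- The operation `V ↦ e_i⁻¹ (d(e_i(V)) + A e_i(V))` on vector fields. -/
def Coframe.covAt (e : Coframe P) (i : ι) (x : X) (A : TangentSpace (𝓡 (d + 1)) x → Mat d)
    (V : ∀ x : X, TangentSpace (𝓡 (d + 1)) x) (v : TangentSpace (𝓡 (d + 1)) x) :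
    TangentSpace (𝓡 (d + 1)) x :=
  (e.form i x).symm (dFun (e.contract i V) x v + A v *ᵥ e.form i x (V x))

/-- Vanishing torsion is the first condition after applying `e_i`; in the second the two terms
containing `A v` cancel because `A v` is `η`-skew. Since `A` is only a function on one tangent
space, the lemma also applies to local connection matrices not yet known to patch. -/
theorem Coframe.leviCivitaAt_covAt (e : Coframe P) {i : ι} {x : X} (hx : x ∈ P.U i)
    {A : TangentSpace (𝓡 (d + 1)) x → Mat d} (hA : ∀ v, A v ∈ so d)
    (htor : ∀ V W : ∀ x : X, TangentSpace (𝓡 (d + 1)) x, VFDiffAt V x → VFDiffAt W x →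
      dForm (e.toForm i) V W x + A (V x) *ᵥ e.form i x (W x) - A (W x) *ᵥ e.form i x (V x) = 0) :
    LeviCivitaAt e x (e.covAt i x A) := by
  refine ⟨fun V W hV hW => ?_, fun V W hV hW v => ?_⟩
  · refine (e.form i x).injective ?_
    have h := htor V W hV hW
    simp only [covAt, map_sub, ContinuousLinearEquiv.apply_symm_apply]
    have hc : ∀ V : ∀ x : X, TangentSpace (𝓡 (d + 1)) x,
        (fun y => e.toForm i y (V y)) = e.contract i V := fun _ => rfl
    rw [← sub_eq_zero, ← h]
    simp only [dForm, hc]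
    simp only [toForm, ContinuousLinearEquiv.coe_coe]
    abel
  · rw [e.dFun_metric hx hV hW, e.metric_eq hx, e.metric_eq hx]
    simp only [covAt, ContinuousLinearEquiv.apply_symm_apply, eta_add_left, eta_add_right,
      eta_mulVec_of_mem_so (hA v)]
    ring

theorem LorentzConnection.IsLeviCivita.leviCivitaAt {Ω : LorentzConnection P} {e : Coframe P}
    (hΩ : Ω.IsLeviCivita e) {i : ι} {x : X} (hx : x ∈ P.U i) :
    LeviCivitaAt e x (e.covAt i x (Ω.eval i x)) :=
  e.leviCivitaAt_covAt hx (Ω.mem i x hx) (hΩ i x hx)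

theorem IsAffineLeviCivita.leviCivitaAt {D : AffineConnection d X} {e : Coframe P}
    (hD : IsAffineLeviCivita D e) (x : X) : LeviCivitaAt e x (fun V v => D V x v) :=
  ⟨fun _ _ hV hW => D.torsion_eq_zero_iff.1 hD.1 hV hW, hD.2 x⟩

theorem isAffineLeviCivita_iff {D : AffineConnection d X} {e : Coframe P} :
    IsAffineLeviCivita D e ↔ ∀ x, LeviCivitaAt e x (fun V v => D V x v) :=
  ⟨fun h => h.leviCivitaAt, fun h => ⟨D.torsion_eq_zero_iff.2 fun {_ _ x} hV hW =>
    (h x).1 _ _ hV hW, fun x => (h x).2⟩⟩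

/-- The affine Levi-Civita connection expressed through the `SO(1,d)`-connection. -/
theorem IsAffineLeviCivita.eq_dCov {D : AffineConnection d X} {e : Coframe P}
    {Ω : LorentzConnection P} (hD : IsAffineLeviCivita D e) (hΩ : Ω.IsLeviCivita e)
    {ξ : ∀ x : X, TangentSpace (𝓡 (d + 1)) x} {i : ι} {x : X} (hx : x ∈ P.U i)
    (hξ : VFDiffAt ξ x) (v : TangentSpace (𝓡 (d + 1)) x) :
    D ξ x v = (e.form i x).symm (Ω.dCov i (e.contract i ξ) x v) :=
  (hD.leviCivitaAt x).unique (hΩ.leviCivitaAt hx) hξ v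

/-! ### Killing fields -/

theorem VF.vfSmoothAt (ξ : VF d X) (x : X) : VFSmoothAt ξ x := ξ.contMDiff x

/-- The matrices are transposes of each other: the direction of differentiation is the second index
of one and the first index of the other. -/
theorem symPart_dCovComp {D : AffineConnection d X} {e : Coframe P}
    {Ω : LorentzConnection P} (hD : IsAffineLeviCivita D e) (hΩ : Ω.IsLeviCivita e)
    {ξ : ∀ x : X, TangentSpace (𝓡 (d + 1)) x} {i : ι} {x : X} (hx : x ∈ P.U i)
    (hξ : VFDiffAt ξ x) :
    symPart (Ω.dCovComp e i ξ x) = symPart (nablaComp D e i ξ x) := by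
  have h : Ω.dCovComp e i ξ x = (nablaComp D e i ξ x)ᵀ := by
    ext a b
    simp only [LorentzConnection.dCovComp, nablaComp, Matrix.of_apply, Matrix.transpose_apply,
      hD.eq_dCov hΩ hx hξ, e.metric_eq hx, Coframe.frame, ContinuousLinearEquiv.apply_symm_apply]
    exact eta_comm _ _
  rw [symPart, symPart, h, Matrix.transpose_transpose, add_comm (nablaComp D e i ξ x)ᵀ]

/-- Expanding the brackets by torsion-freeness and the derivative of `g` by compatibility, the terms
with `∇_ξ V` and `∇_ξ W` cancel. -/
theorem lieMetric_eq {D : AffineConnection d X} {e : Coframe P} (hD : IsAffineLeviCivita D e)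
    {ξ V W : ∀ x : X, TangentSpace (𝓡 (d + 1)) x} {x : X} (hξ : VFDiffAt ξ x)
    (hV : VFDiffAt V x) (hW : VFDiffAt W x) :
    e.lieMetric ξ V W x = e.metric x (D ξ x (V x)) (W x) + e.metric x (D ξ x (W x)) (V x) := by
  have h := hD.leviCivitaAt x
  unfold Coframe.lieMetric
  rw [h.2 V W hV hW, ← h.1 ξ V hξ hV, ← h.1 ξ W hξ hW, e.metric_sub_left, e.metric_sub_right,
    e.metric_comm x _ (V x)]
  ring

theorem Coframe.sum_frame (e : Coframe P) (i : ι) {x : X} (v : TangentSpace (𝓡 (d + 1)) x) :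
    v = ∑ a, e.form i x v a • e.frame i a x := by
  refine (e.form i x).injective ?_
  rw [map_sum]
  ext b
  simp [Coframe.frame, Pi.single_apply]

/-- Both conditions say that the symmetrization of the bilinear form `g(∇_v ξ, w)` vanishes, tested
once on a frame and once on arbitrary fields. -/
theorem killing_iff {D : AffineConnection d X} {e : Coframe P} (hD : IsAffineLeviCivita D e)
    (ξ : VF d X) : (∀ i, ∀ x ∈ P.U i, symPart (nablaComp D e i ξ x) = 0) ↔
      e.LieMetricVanishes ξ := by
  constructor
  · intro h x V W hV hW
    obtain ⟨i, hx⟩ := P.cover x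
    rw [lieMetric_eq hD (VF.vfSmoothAt ξ x).vfDiffAt hV hW]
    let Q : TangentSpace (𝓡 (d + 1)) x →ₗ[ℝ] TangentSpace (𝓡 (d + 1)) x →ₗ[ℝ] ℝ :=
      (etaBilin d).compl₁₂ ((e.form i x).toLinearMap ∘ₗ (D ξ x).toLinearMap) (e.form i x).toLinearMap
    have hQ : ∀ v w, Q v w = e.metric x (D ξ x v) w := fun v w => by
      rw [e.metric_eq hx]; simp [Q, etaBilin_apply]
    have hs : Q + Q.flip = 0 := by
      let b := (Pi.basisFun ℝ (Fin (d + 1))).map (e.form i x).symm.toLinearEquiv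
      have hb : ∀ a, b a = e.frame i a x := fun a => by simp [b, Coframe.frame]
      refine b.ext fun a => b.ext fun c => ?_
      have h1 := congr_fun (congr_fun (h i x hx) a) c
      simp [symPart, nablaComp] at h1
      simp [hb, hQ, h1]
    have := DFunLike.congr_fun (DFunLike.congr_fun hs (V x)) (W x)
    simpa [hQ] using this
  · intro h i x hx
    ext a c
    have h1 := h x (e.frame i a) (e.frame i c) (e.vfSmoothAt_frame hx a).vfDiffAt
      (e.vfSmoothAt_frame hx c).vfDiffAt
    rw [lieMetric_eq hD (VF.vfSmoothAt ξ x).vfDiffAt (e.vfSmoothAt_frame hx a).vfDiffAt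
      (e.vfSmoothAt_frame hx c).vfDiffAt] at h1
    simp [symPart, nablaComp, h1]

/-- The defining identity pairs `L^K_ξ e` with `e(W)`. Every vector of `ℝ^{1,d}` is such a value at
the given point, so nondegeneracy of `η` applies. -/
theorem kosmann_vanishes_iff {K : CovariantLie P} {e : Coframe P} (hK : K.IsKosmann e)
    (ξ : VF d X) : K.VanishesOnCoframe e ξ ↔ e.LieMetricVanishes ξ := by
  constructor
  · intro h x V W hV hW
    obtain ⟨i, hx⟩ := P.cover x
    rw [hK ξ i x hx V W hV hW, h i x hx V hV]
    simp [eta]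
  · intro h i x hx V hV
    refine eq_zero_of_eta_eq_zero fun u => ?_
    obtain ⟨W, hW, hWu⟩ := exists_vfSmoothAt_eq ((e.form i x).symm u)
    have h1 := hK ξ i x hx V W hV hW.vfDiffAt
    rw [h x V W hV hW.vfDiffAt, hWu, ContinuousLinearEquiv.apply_symm_apply] at h1
    linarith

end LeviCivita

/-! ### Tensoriality of the exterior derivative of a 1-form. -/

section ExteriorDerivative

variable {d : ℕ} {X : Type*} [TopologicalSpace X]
  [ChartedSpace (EuclideanSpace ℝ (Fin (d + 1))) X]
  {F : Type*} [NormedAddCommGroup F] [NormedSpace ℝ F]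
  {θ : ∀ x : X, TangentSpace (𝓡 (d + 1)) x →L[ℝ] F} {x : X}

theorem dForm_swap (V W : ∀ x : X, TangentSpace (𝓡 (d + 1)) x) :
    dForm θ V W x = - dForm θ W V x := by
  unfold dForm
  rw [VectorField.mlieBracket_swap_apply, map_neg]
  abel

variable [IsManifold (𝓡 (d + 1)) ∞ X]

/-- The derivative of `f` arises once from `d(θ(fV))(W)` and once from the bracket `[fV, W]`, with
opposite signs. Tensoriality later reduces the torsion to its values on frame fields. -/
theorem tensorialAt_dForm_left (hθ : SmoothFormAt θ x)
    (W : ∀ x : X, TangentSpace (𝓡 (d + 1)) x) :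
    TensorialAt (𝓡 (d + 1)) (EuclideanSpace ℝ (Fin (d + 1))) (fun V => dForm θ V W x) x where
  smul {f V} hf hV := by
    have h1 : dFun (fun y => θ y ((f • V) y)) x (W x) =
        dFun (d := d) f x (W x) • θ x (V x) + f x • dFun (fun y => θ y (V y)) x (W x) := by
      have h := dFun_bilin (ContinuousLinearMap.lsmul ℝ ℝ : ℝ →L[ℝ] F →L[ℝ] F) hf
        (hθ.mdifferentiableAt_apply hV) (W x)
      simpa using h
    have h2 := VectorField.mlieBracket_smul_left (W := W) hf hV
    change _ = - (dFun (d := d) f x (W x)) • _ + _ at h2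
    simp only [dForm, h1, h2]
    simp only [Pi.smul_apply', map_add, map_smul, smul_sub]
    module
  add {V V'} hV hV' := by
    have h1 : dFun (fun y => θ y ((V + V') y)) x (W x) =
        dFun (fun y => θ y (V y)) x (W x) + dFun (fun y => θ y (V' y)) x (W x) := by
      simp only [Pi.add_apply, map_add]
      exact dFun_add (hθ.mdifferentiableAt_apply hV) (hθ.mdifferentiableAt_apply hV') (W x)
    simp only [dForm, h1, VectorField.mlieBracket_add_left (W := W) hV hV']
    simp only [Pi.add_apply, map_add]
    abel

theorem tensorialAt_dForm_right (hθ : SmoothFormAt θ x)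
    (V : ∀ x : X, TangentSpace (𝓡 (d + 1)) x) :
    TensorialAt (𝓡 (d + 1)) (EuclideanSpace ℝ (Fin (d + 1))) (fun W => dForm θ V W x) x where
  smul hf hW := by
    simp only [dForm_swap V, (tensorialAt_dForm_left hθ V).smul hf hW, smul_neg]
  add hW hW' := by
    simp only [dForm_swap V, (tensorialAt_dForm_left hθ V).add hW hW', neg_add]

/-- The value of the exterior derivative at a point, as a bilinear map. -/
theorem exists_dForm_eq_bilin (hθ : SmoothFormAt θ x) :
    ∃ T : TangentSpace (𝓡 (d + 1)) x →L[ℝ] TangentSpace (𝓡 (d + 1)) x →L[ℝ] F,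
      ∀ V W : ∀ x : X, TangentSpace (𝓡 (d + 1)) x, VFDiffAt V x → VFDiffAt W x →
        dForm θ V W x = T (V x) (W x) :=
  ⟨TensorialAt.mkHom₂ (fun V W => dForm θ V W x) x (fun W _ => tensorialAt_dForm_left hθ W)
    (fun V _ => tensorialAt_dForm_right hθ V), fun _ _ hV hW =>
    (TensorialAt.mkHom₂_apply (Φ := fun V W => dForm θ V W x) _ _ hV hW).symm⟩

end ExteriorDerivative

/-! ### Construction of the Lorentzian Levi-Civita connection. -/

section ExistsConnection

variable {d : ℕ} {X : Type*} [TopologicalSpace X]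
  [ChartedSpace (EuclideanSpace ℝ (Fin (d + 1))) X]
  {ι : Type*} {P : LorentzBundle d X ι}

namespace LorentzBundle

/-- The cocycle identity makes `γ i i x` idempotent, and its determinant is `1`. -/
theorem γ_self {i : ι} {x : X} (hx : x ∈ P.U i) : P.γ i i x = 1 := by
  have h := P.γ_cocycle i i i x ⟨⟨hx, hx⟩, hx⟩
  have hu : IsUnit (P.γ i i x) :=
    (Matrix.isUnit_iff_isUnit_det _).2 (by rw [(P.γ_mem i i x ⟨hx, hx⟩).2]; exact isUnit_one)
  exact hu.mul_eq_left.1 h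

theorem γ_mul_γ {i j : ι} {x : X} (hx : x ∈ P.U i ∩ P.U j) : P.γ i j x * P.γ j i x = 1 := by
  rw [P.γ_cocycle i j i x ⟨hx, hx.1⟩, γ_self hx.1]

end LorentzBundle

variable [IsManifold (𝓡 (d + 1)) ∞ X]

namespace Coframe

variable (e : Coframe P) (i : ι)

theorem form_frame (a : Fin (d + 1)) (x : X) :
    e.form i x (e.frame i a x) = Pi.single a 1 := by
  simp [frame]

/-- The structure coefficients of the coframe, with all indices lowered. -/
def structureCoeff (a b c : Fin (d + 1)) (x : X) : ℝ :=
  - (etaSign a * e.form i x (VectorField.mlieBracket (𝓡 (d + 1)) (e.frame i b) (e.frame i c) x) a)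

theorem structureCoeff_swap (a b c : Fin (d + 1)) (x : X) :
    e.structureCoeff i a b c x = - e.structureCoeff i a c b x := by
  unfold structureCoeff
  rw [VectorField.mlieBracket_swap_apply, map_neg]
  simp

/-- The Levi-Civita connection coefficients `ω_{ab}(ê_c)`, with all indices lowered. -/
def connectionCoeff (a b c : Fin (d + 1)) (x : X) : ℝ :=
  1 / 2 * (e.structureCoeff i a b c x - e.structureCoeff i b a c x - e.structureCoeff i c a b x)

/-- The Levi-Civita connection forms `ω^a_b` of the coframe over `U i`. -/
def leviCivitaForm (a b : Fin (d + 1)) (x : X) : TangentSpace (𝓡 (d + 1)) x →L[ℝ] ℝ :=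
  ∑ c, (etaSign a * e.connectionCoeff i a b c x) •
    (ContinuousLinearMap.proj (R := ℝ) (φ := fun _ : Fin (d + 1) => ℝ) c).comp (e.toForm i x)

/-- The matrix `ω(v)` of the Levi-Civita connection forms. -/
def leviCivitaMat (x : X) (v : TangentSpace (𝓡 (d + 1)) x) : Mat d :=
  Matrix.of fun a b => e.leviCivitaForm i a b x v

/-- The lowered coefficients are antisymmetric in `a, b`: the first two structure terms are
exchanged, and the third is antisymmetric itself. -/
theorem leviCivitaMat_mem_so (x : X) (v : TangentSpace (𝓡 (d + 1)) x) :
    e.leviCivitaMat i x v ∈ so d := by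
  refine mem_so_iff_apply.2 fun a b => ?_
  simp only [leviCivitaMat, leviCivitaForm, Matrix.of_apply, _root_.sum_apply,
    Finset.mul_sum, ← Finset.sum_neg_distrib]
  refine Finset.sum_congr rfl fun c _ => ?_
  simp only [_root_.smul_apply, smul_eq_mul, connectionCoeff]
  have h1 := etaSign_mul_self a
  have h2 := etaSign_mul_self b
  rw [e.structureCoeff_swap i c a b]
  linear_combination
    (1 / 2 * (e.structureCoeff i a b c x - e.structureCoeff i b a c x +
      e.structureCoeff i c b a x) *
      (ContinuousLinearMap.proj (R := ℝ) (φ := fun _ : Fin (d + 1) => ℝ) c).comp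
        (e.toForm i x) v) * (h1 - h2)

theorem leviCivitaForm_frame (a b c : Fin (d + 1)) (x : X) :
    e.leviCivitaForm i a b x (e.frame i c x) = etaSign a * e.connectionCoeff i a b c x := by
  simp [leviCivitaForm, toForm, form_frame, Pi.single_apply]

/-- The coframe takes constant values on its own frame, so only the bracket term survives. -/
theorem dForm_frame (b c : Fin (d + 1)) (x : X) :
    dForm (e.toForm i) (e.frame i b) (e.frame i c) x =
      - e.form i x (VectorField.mlieBracket (𝓡 (d + 1)) (e.frame i b) (e.frame i c) x) := by
  have h : ∀ b, (fun y => e.toForm i y (e.frame i b y)) = fun _ => Pi.single b 1 :=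
    fun b => funext fun y => e.form_frame i b y
  simp only [dForm, h, dFun_const]
  simp [toForm]

variable {i}

/-- The frame as a basis of the tangent space. -/
theorem exists_basis_eq_frame (x : X) :
    ∃ b : Module.Basis (Fin (d + 1)) ℝ (TangentSpace (𝓡 (d + 1)) x), ∀ a, b a = e.frame i a x :=
  ⟨(Pi.basisFun ℝ (Fin (d + 1))).map (e.form i x).symm.toLinearEquiv,
    fun a => by simp [Coframe.frame]⟩

/-- By bilinearity it suffices to insert frame vectors. In `ω_{ac}(ê_b) - ω_{ab}(ê_c)` the structure
terms `bac` and `cab` cancel, and the rest is minus the `abc` coefficient of `de`. -/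
theorem torsion_leviCivitaMat {x : X} (hx : x ∈ P.U i)
    {V W : ∀ x : X, TangentSpace (𝓡 (d + 1)) x} (hV : VFDiffAt V x) (hW : VFDiffAt W x) :
    dForm (e.toForm i) V W x + e.leviCivitaMat i x (V x) *ᵥ e.form i x (W x)
      - e.leviCivitaMat i x (W x) *ᵥ e.form i x (V x) = 0 := by
  obtain ⟨T, hT⟩ := exists_dForm_eq_bilin (e.smoothFormAt hx)
  obtain ⟨β, hβ⟩ := e.exists_basis_eq_frame (i := i) x
  ext a
  let S : TangentSpace (𝓡 (d + 1)) x →ₗ[ℝ] TangentSpace (𝓡 (d + 1)) x →ₗ[ℝ] ℝ :=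
    ∑ b, (LinearMap.mul ℝ ℝ).compl₁₂ (e.leviCivitaForm i a b x).toLinearMap
      (LinearMap.proj b ∘ₗ (e.form i x).toLinearMap)
  let T' : TangentSpace (𝓡 (d + 1)) x →ₗ[ℝ] TangentSpace (𝓡 (d + 1)) x →ₗ[ℝ] ℝ :=
    (T.toLinearMap₁₂).compr₂ (LinearMap.proj a)
  have hS : ∀ v w, S v w = (e.leviCivitaMat i x v *ᵥ e.form i x w) a := fun v w => by
    simp [S, Matrix.mulVec, dotProduct, leviCivitaMat]
  have hz : T' + S - S.flip = 0 := by
    refine β.ext fun b => β.ext fun c => ?_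
    have h1 := congr_fun (hT _ _ (e.vfSmoothAt_frame hx b).vfDiffAt
      (e.vfSmoothAt_frame hx c).vfDiffAt) a
    simp only [LinearMap.add_apply, LinearMap.sub_apply, LinearMap.flip_apply, hS, hβ, form_frame,
      LinearMap.zero_apply]
    have h2 : T' (e.frame i b x) (e.frame i c x) = T (e.frame i b x) (e.frame i c x) a := rfl
    rw [h2, ← h1, dForm_frame]
    simp only [Matrix.mulVec_single_one, leviCivitaMat, Matrix.col_apply, Matrix.of_apply,
      leviCivitaForm_frame, connectionCoeff, Pi.neg_apply]
    rw [e.structureCoeff_swap i a c b, e.structureCoeff_swap i b a c, 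
      e.structureCoeff_swap i c a b]
    have h3 : e.form i x (VectorField.mlieBracket (𝓡 (d + 1)) (e.frame i b) (e.frame i c) x) a =
        - (etaSign a * e.structureCoeff i a b c x) := by
      rw [structureCoeff, mul_neg, ← mul_assoc, etaSign_mul_self]; ring
    rw [h3]
    ring
  have h := DFunLike.congr_fun (DFunLike.congr_fun hz (V x)) (W x)
  simp only [LinearMap.add_apply, LinearMap.sub_apply, LinearMap.flip_apply, hS] at h
  rw [hT V W hV hW]
  exact h

theorem leviCivitaAt_leviCivitaMat {x : X} (hx : x ∈ P.U i) :
    LeviCivitaAt e x (e.covAt i x (e.leviCivitaMat i x)) :=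
  e.leviCivitaAt_covAt hx (e.leviCivitaMat_mem_so i x) fun _ _ => e.torsion_leviCivitaMat hx

theorem smoothFormAt_leviCivitaForm {x : X} (hx : x ∈ P.U i) (a b : Fin (d + 1)) :
    SmoothFormAt (e.leviCivitaForm i a b) x := by
  have hC : ∀ a b c, ContMDiffAt (𝓡 (d + 1)) 𝓘(ℝ, ℝ) ∞ (e.structureCoeff i a b c) x := by
    intro a b c
    have hbr : VFSmoothAt
        (VectorField.mlieBracket (𝓡 (d + 1)) (e.frame i b) (e.frame i c)) x := by
      have : IsManifold (𝓡 (d + 1)) (minSmoothness ℝ 2) X := by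
        rw [minSmoothness_of_isRCLikeNormedField]; infer_instance
      -- The bracket costs one derivative, which is harmless because `∞ + 1 = ∞`.
      have : IsManifold (𝓡 (d + 1)) (((⊤ : ℕ∞) : WithTop ℕ∞) + 1) X :=
        inferInstanceAs (IsManifold (𝓡 (d + 1)) ∞ X)
      exact ContMDiffAt.mlieBracket_vectorField (m := ⊤) (n := ⊤) (e.vfSmoothAt_frame hx b)
        (e.vfSmoothAt_frame hx c) (by simp)
    have h := contMDiffAt_pi_space.1 ((e.smoothFormAt hx).apply hbr) a
    exact (contMDiffAt_const.mul h).neg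
  refine SmoothFormAt.sum fun c _ => SmoothFormAt.smul ?_ ((e.smoothFormAt hx).clm_comp _)
  exact contMDiffAt_const.mul (contMDiffAt_const.mul (((hC a b c).sub (hC b a c)).sub (hC c a b)))

/-- Uniqueness at `x` is applied to the frame field `ê_b` of gauge `j`. In gauge `j` its components
are constant, which leaves column `b` of `ω_j`; in gauge `i` they form column `b` of `γ_{ij}`, whose
differential is the inhomogeneous term. -/
theorem leviCivitaMat_patch {i j : ι} {x : X} (hx : x ∈ P.U i ∩ P.U j)
    (v : TangentSpace (𝓡 (d + 1)) x) :
    e.leviCivitaMat j x v = P.γ j i x * e.leviCivitaMat i x v * P.γ i j x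
        + P.γ j i x * dMat (P.γ i j) x v := by
  refine Matrix.ext_of_mulVec_single fun b => ?_
  have h := (e.leviCivitaAt_leviCivitaMat hx.1).unique (e.leviCivitaAt_leviCivitaMat hx.2)
    (e.vfSmoothAt_frame hx.2 b).vfDiffAt v
  have hj : e.contract j (e.frame j b) = fun _ => Pi.single b 1 :=
    funext fun y => e.form_frame j b y
  have hfr : ∀ y ∈ P.U i ∩ P.U j, e.form i y (e.frame j b y) = P.γ i j y *ᵥ Pi.single b 1 := by
    intro y hy
    rw [e.patch j i y hy.symm, form_frame]
  have hγ : dFun (e.contract i (e.frame j b)) x v = dMat (P.γ i j) x v *ᵥ Pi.single b 1 := by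
    have hmem : P.U i ∩ P.U j ∈ nhds x := ((P.isOpen i).inter (P.isOpen j)).mem_nhds hx
    have h1 : e.contract i (e.frame j b) =ᶠ[nhds x] fun y a => P.γ i j y a b := by
      filter_upwards [hmem] with y hy
      exact (hfr y hy).trans (by simp; rfl)
    rw [dFun_congr h1]
    ext a
    have h2 : MDifferentiableAt (𝓡 (d + 1)) 𝓘(ℝ, Mink d) (fun y a => P.γ i j y a b) x :=
      mdifferentiableAt_pi fun a =>
        ((P.γ_smooth i j a b).contMDiffAt hmem).mdifferentiableAt (by simp)
    rw [← dFun_apply h2]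
    simp [dMat]
  have h' := congrArg (e.form j x) h
  unfold covAt at h'
  rw [e.patch i j x hx] at h'
  simp only [ContinuousLinearEquiv.apply_symm_apply, hj, dFun_const, hγ, hfr x hx,
    form_frame] at h'
  rw [zero_apply, zero_add] at h'
  rw [← h', Matrix.add_mulVec, Matrix.mulVec_add]
  simp only [← Matrix.mulVec_mulVec]
  exact add_comm _ _

/-- The Levi-Civita connection of a coframe. -/
def leviCivita : LorentzConnection P where
  form i a b := e.leviCivitaForm i a b
  smooth i a b := (smoothFormOn_iff (P.isOpen i)).2 fun _ hx => e.smoothFormAt_leviCivitaForm hx a b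
  mem i x _ := e.leviCivitaMat_mem_so i x
  patch _ _ _ hx := e.leviCivitaMat_patch hx

theorem isLeviCivita_leviCivita : e.leviCivita.IsLeviCivita e :=
  fun _ _ hx _ _ => e.torsion_leviCivitaMat hx

end Coframe

end ExistsConnection

/-! ### Construction of a smooth affine Levi-Civita connection. -/

section ExistsAffine

variable {d : ℕ} {X : Type*} [TopologicalSpace X]
  [ChartedSpace (EuclideanSpace ℝ (Fin (d + 1))) X] [IsManifold (𝓡 (d + 1)) ∞ X]
  {ι : Type*} {P : LorentzBundle d X ι}

namespace LorentzConnection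

variable (Ω : LorentzConnection P)

/-- The components of the covariant derivative `d^ω φ` over `U i`, as 1-forms. -/
def covForm (i : ι) (φ : X → Mink d) (a : Fin (d + 1)) (x : X) :
    TangentSpace (𝓡 (d + 1)) x →L[ℝ] ℝ :=
  (ContinuousLinearMap.proj (R := ℝ) (φ := fun _ : Fin (d + 1) => ℝ) a).comp (dFun φ x) +
    ∑ b, φ x b • Ω.form i a b x

theorem covForm_apply (i : ι) (φ : X → Mink d) (a : Fin (d + 1)) (x : X)
    (v : TangentSpace (𝓡 (d + 1)) x) : Ω.covForm i φ a x v = Ω.dCov i φ x v a := by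
  simp [covForm, dCov, eval, Matrix.mulVec, dotProduct, mul_comm]

theorem smoothFormAt_covForm {i : ι} {x : X} (hx : x ∈ P.U i) {φ : X → Mink d}
    (hφ : ContMDiffAt (𝓡 (d + 1)) 𝓘(ℝ, Mink d) ∞ φ x) (a : Fin (d + 1)) :
    SmoothFormAt (Ω.covForm i φ a) x :=
  ((smoothFormAt_dFun hφ).clm_comp _).add (SmoothFormAt.sum fun b _ =>
    SmoothFormAt.smul (contMDiffAt_pi_space.1 hφ b)
      ((smoothFormOn_iff (P.isOpen i)).1 (Ω.smooth i a b) x hx))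

/-- The covariant derivative `e_i⁻¹ (d^ω e_i(V))` of vector fields over `U i`. -/
def localCov (e : Coframe P) (i : ι) (V : ∀ x : X, TangentSpace (𝓡 (d + 1)) x) (x : X) :
    TangentSpace (𝓡 (d + 1)) x →L[ℝ] TangentSpace (𝓡 (d + 1)) x :=
  ∑ a, (Ω.covForm i (e.contract i V) a x).smulRight (e.frame i a x)

theorem localCov_apply (e : Coframe P) (i : ι) (V : ∀ x : X, TangentSpace (𝓡 (d + 1)) x) (x : X)
    (v : TangentSpace (𝓡 (d + 1)) x) :
    Ω.localCov e i V x v = (e.form i x).symm (Ω.dCov i (e.contract i V) x v) := by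
  rw [e.sum_frame i ((e.form i x).symm (Ω.dCov i (e.contract i V) x v))]
  simp [localCov, covForm_apply]

theorem localCov_add (e : Coframe P) {i : ι} {x : X} (hx : x ∈ P.U i)
    {V W : ∀ x : X, TangentSpace (𝓡 (d + 1)) x} (hV : VFDiffAt V x) (hW : VFDiffAt W x) :
    Ω.localCov e i (V + W) x = Ω.localCov e i V x + Ω.localCov e i W x := by
  ext1 v
  have h : e.contract i (V + W) = fun y => e.contract i V y + e.contract i W y :=
    funext fun y => map_add (e.form i y) _ _
  rw [add_apply, localCov_apply, localCov_apply, localCov_apply, ← map_add, h]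
  simp only [dCov]
  rw [dFun_add (e.mdifferentiableAt_contract hx hV) (e.mdifferentiableAt_contract hx hW),
    Matrix.mulVec_add]
  congr 1
  abel

theorem localCov_smul (e : Coframe P) {i : ι} {x : X} (hx : x ∈ P.U i) {f : X → ℝ}
    {V : ∀ x : X, TangentSpace (𝓡 (d + 1)) x} (hV : VFDiffAt V x)
    (hf : MDifferentiableAt (𝓡 (d + 1)) 𝓘(ℝ, ℝ) f x) :
    Ω.localCov e i (f • V) x =
      f x • Ω.localCov e i V x + (dFun (d := d) f x).smulRight (V x) := by
  ext1 v
  have h : e.contract i (f • V) = fun y => f y • e.contract i V y :=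
    funext fun y => map_smul (e.form i y) _ _
  have h1 := dFun_bilin (ContinuousLinearMap.lsmul ℝ ℝ : ℝ →L[ℝ] Mink d →L[ℝ] Mink d) hf
        (e.mdifferentiableAt_contract hx hV) v
  simp only [ContinuousLinearMap.lsmul_apply] at h1
  rw [add_apply, smul_apply, localCov_apply, localCov_apply, h]
  simp only [dCov]
  rw [h1, Matrix.mulVec_smul]
  refine (e.form i x).injective ?_
  simp only [ContinuousLinearMap.smulRight_apply, map_add, map_smul,
    ContinuousLinearEquiv.apply_symm_apply, Coframe.contract]
  module

variable {Ω}

theorem IsLeviCivita.leviCivitaAt_localCov {e : Coframe P} (hΩ : Ω.IsLeviCivita e) {i : ι} {x : X}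
    (hx : x ∈ P.U i) : LeviCivitaAt e x (fun V v => Ω.localCov e i V x v) := by
  simp only [localCov_apply]
  exact hΩ.leviCivitaAt hx

variable (Ω)

/-- The affine connection `e⁻¹ (d^ω e(V))`. -/
def affine (e : Coframe P) : AffineConnection d X where
  -- The gauge is chosen separately at each point; additivity and the Leibniz rule are statements at
  -- one point, so they do not see the choice.
  toFun V x := Ω.localCov e (P.cover x).choose V x
  isCovariantDerivativeOnUniv :=
    { add := fun {_ _ x} hV hW _ => Ω.localCov_add e (P.cover x).choose_spec hV hW
      leibniz := fun {_ _ x} hV hf _ => Ω.localCov_smul e (P.cover x).choose_spec hV hf }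

variable {Ω}

theorem IsLeviCivita.isAffineLeviCivita_affine {e : Coframe P} (hΩ : Ω.IsLeviCivita e) :
    IsAffineLeviCivita (Ω.affine e) e :=
  isAffineLeviCivita_iff.2 fun x => hΩ.leviCivitaAt_localCov (P.cover x).choose_spec

/-- Near `x` one fixed gauge gives a smooth expression, and uniqueness at each nearby `y` identifies
it with the expression in the gauge chosen at `y`. -/
theorem IsLeviCivita.contMDiff_affine {e : Coframe P} (hΩ : Ω.IsLeviCivita e) :
    CovariantDerivative.ContMDiffCovariantDerivative (Ω.affine e) ∞ where
  contMDiff :=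
    { contMDiff := fun {V} hV x _ => by
        have hV' : ∀ y, VFSmoothAt V y := fun y => (hV y trivial).contMDiffAt Filter.univ_mem
        obtain ⟨i, hx⟩ := P.cover x
        refine ContMDiffAt.contMDiffWithinAt ?_
        have h := ContMDiffAt.sum_section (s := Finset.univ) (fun a _ => smooth_smulRight
          (Ω.smoothFormAt_covForm hx (e.contMDiffAt_contract hx (hV' x)) a)
          (e.vfSmoothAt_frame hx a))
        refine h.congr_of_eventuallyEq ?_
        filter_upwards [(P.isOpen i).mem_nhds hx] with y hy
        refine congrArg (TotalSpace.mk' _ y) ?_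
        ext1 v
        exact (hΩ.isAffineLeviCivita_affine.leviCivitaAt y).unique
          (hΩ.leviCivitaAt_localCov hy) (hV' y).vfDiffAt v }

end LorentzConnection

end ExistsAffine

/-! ### Construction of the Kosmann Lie derivative. -/

section ExistsKosmann

variable {d : ℕ}

/-- The adjoint of a matrix with respect to the Minkowski pairing. -/
def etaAdjoint (A : Mat d) : Mat d := etaMat d * Aᵀ * etaMat d

/-- The component in `𝔰𝔬(1,d)` of a matrix. -/
def soPart (A : Mat d) : Mat d := (1 / 2 : ℝ) • (A - etaAdjoint A)

theorem etaMat_mul_self : etaMat d * etaMat d = 1 := by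
  rw [etaMat_eq, Matrix.diagonal_mul_diagonal]
  simp [etaSign_mul_self]

theorem etaAdjoint_apply (A : Mat d) (a b : Fin (d + 1)) :
    etaAdjoint A a b = etaSign a * A b a * etaSign b := by
  simp [etaAdjoint, etaMat_eq]

theorem soPart_mem (A : Mat d) : soPart A ∈ so d := by
  refine mem_so_iff_apply.2 fun a b => ?_
  simp only [soPart, Matrix.smul_apply, Matrix.sub_apply, etaAdjoint_apply, smul_eq_mul]
  linear_combination (-1 / 2 * A b a * etaSign b) * etaSign_mul_self a +
    (-1 / 2 * A a b * etaSign a) * etaSign_mul_self b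

theorem soPart_add (A B : Mat d) : soPart (A + B) = soPart A + soPart B := by
  ext a b
  simp only [soPart, Matrix.smul_apply, Matrix.sub_apply, Matrix.add_apply, etaAdjoint_apply,
    smul_eq_mul]
  ring

theorem soPart_smul (c : ℝ) (A : Mat d) : soPart (c • A) = c • soPart A := by
  ext a b
  simp only [soPart, Matrix.smul_apply, Matrix.sub_apply, etaAdjoint_apply, smul_eq_mul]
  ring

theorem eta_etaAdjoint_mulVec (A : Mat d) (u v : Mink d) :
    eta (etaAdjoint A *ᵥ u) v = eta u (A *ᵥ v) := by
  have h1 : ∀ (B : Mat d) (u w : Mink d), (B *ᵥ u) ⬝ᵥ w = u ⬝ᵥ (Bᵀ *ᵥ w) := fun B u w => by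
    rw [dotProduct_comm, Matrix.dotProduct_mulVec, ← Matrix.mulVec_transpose, dotProduct_comm]
  have ht : (etaMat d)ᵀ = etaMat d := Matrix.diagonal_transpose _
  unfold eta
  rw [h1, Matrix.mulVec_mulVec, Matrix.mulVec_mulVec]
  simp only [etaAdjoint, Matrix.transpose_mul, Matrix.transpose_transpose, ht]
  rw [Matrix.mul_assoc, Matrix.mul_assoc, etaMat_mul_self, Matrix.mul_one]

/-- Removing the skew part leaves half of `A` plus its `η`-adjoint. With `A = ∇ξ` the right-hand
side is `L_ξ g`. -/
theorem two_mul_eta_sub_soPart (A : Mat d) (u v : Mink d) :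
    2 * eta (A *ᵥ u - soPart A *ᵥ u) v = eta (A *ᵥ u) v + eta (A *ᵥ v) u := by
  have h : A - soPart A = (1 / 2 : ℝ) • (A + etaAdjoint A) := by
    unfold soPart; module
  rw [← Matrix.sub_mulVec, h, eta_comm (A *ᵥ v) u, ← eta_etaAdjoint_mulVec, ← eta_add_left,
    ← Matrix.add_mulVec, Matrix.smul_mulVec, ← etaBilin_apply, map_smul,
    LinearMap.smul_apply, etaBilin_apply, smul_eq_mul]
  ring

/-- For Lorentz matrices `Aᵀ η = η A⁻¹`, so the `η`-adjoint commutes with conjugation. This makes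
the correction `(∇ξ)_{𝔰𝔬}` independent of the gauge. -/
theorem soPart_conj {A B : Mat d} (hA : A ∈ SO d) (hB : B ∈ SO d) (h : A * B = 1) (N : Mat d) :
    soPart (B * N * A) = B * soPart N * A := by
  have key : ∀ {A B : Mat d}, A ∈ SO d → A * B = 1 → Aᵀ * etaMat d = etaMat d * B := by
    intro A B hA h
    calc Aᵀ * etaMat d = Aᵀ * etaMat d * (A * B) := by rw [h, mul_one]
      _ = (Aᵀ * etaMat d * A) * B := by simp only [mul_assoc]
      _ = etaMat d * B := by rw [hA.1]
  have h1 := key hA h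
  have h2 := key hB (mul_eq_one_comm.1 h)
  have h3 : etaMat d * Aᵀ = B * etaMat d := by
    calc etaMat d * Aᵀ = etaMat d * (Aᵀ * etaMat d) * etaMat d := by
          simp only [mul_assoc, etaMat_mul_self, mul_one]
      _ = etaMat d * etaMat d * B * etaMat d := by rw [h1]; simp only [mul_assoc]
      _ = B * etaMat d := by rw [etaMat_mul_self, one_mul]
  have h4 : etaAdjoint (B * N * A) = B * etaAdjoint N * A := by
    calc etaAdjoint (B * N * A) = (etaMat d * Aᵀ) * Nᵀ * (Bᵀ * etaMat d) := by
          simp only [etaAdjoint, Matrix.transpose_mul, mul_assoc]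
      _ = B * etaAdjoint N * A := by rw [h3, h2]; simp only [etaAdjoint, mul_assoc]
  unfold soPart
  rw [h4, mul_smul_comm, smul_mul_assoc, mul_sub, sub_mul]

variable {X : Type*} [TopologicalSpace X]
  [ChartedSpace (EuclideanSpace ℝ (Fin (d + 1))) X]

theorem contMDiffAt_soPart {N : X → Mat d} {x : X}
    (hN : ∀ a b, ContMDiffAt (𝓡 (d + 1)) 𝓘(ℝ, ℝ) ∞ (fun y => N y a b) x) (a b : Fin (d + 1)) :
    ContMDiffAt (𝓡 (d + 1)) 𝓘(ℝ, ℝ) ∞ (fun y => soPart (N y) a b) x := by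
  have h : (fun y => soPart (N y) a b) =
      fun y => 1 / 2 * (N y a b - etaSign a * N y b a * etaSign b) := by
    funext y
    simp [soPart, etaAdjoint_apply]
  rw [h]
  exact contMDiffAt_const.mul ((hN a b).sub ((contMDiffAt_const.mul (hN b a)).mul contMDiffAt_const))

variable [IsManifold (𝓡 (d + 1)) ∞ X] {ι : Type*} {P : LorentzBundle d X ι}

/-- The matrix of `∇ξ` in the frame over `U i`. -/
def nablaMat (D : AffineConnection d X) (e : Coframe P) (i : ι)
    (ξ : ∀ x : X, TangentSpace (𝓡 (d + 1)) x) (x : X) : Mat d :=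
  Matrix.of fun a b => e.form i x (D ξ x (e.frame i b x)) a

theorem nablaMat_mulVec (D : AffineConnection d X) (e : Coframe P) (i : ι)
    (ξ : ∀ x : X, TangentSpace (𝓡 (d + 1)) x) (x : X) (v : TangentSpace (𝓡 (d + 1)) x) :
    nablaMat D e i ξ x *ᵥ e.form i x v = e.form i x (D ξ x v) := by
  ext a
  conv_rhs => rw [e.sum_frame i v]
  simp [nablaMat, Matrix.mulVec, dotProduct, mul_comm]

/-- `∇ξ` is an endomorphism of the tangent space, so it changes by conjugation with no inhomogeneous
term. -/
theorem nablaMat_patch (D : AffineConnection d X) (e : Coframe P) {i j : ι} {x : X}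
    (hx : x ∈ P.U i ∩ P.U j) (ξ : ∀ x : X, TangentSpace (𝓡 (d + 1)) x) :
    nablaMat D e j ξ x = P.γ j i x * nablaMat D e i ξ x * P.γ i j x := by
  refine Matrix.ext_of_mulVec_single fun b => ?_
  rw [← e.form_frame j b x, nablaMat_mulVec, ← Matrix.mulVec_mulVec, ← Matrix.mulVec_mulVec,
    ← e.patch j i x hx.symm, nablaMat_mulVec, e.patch i j x hx]

theorem contMDiffAt_nablaMat {D : AffineConnection d X}
    (hD : CovariantDerivative.ContMDiffCovariantDerivative D ∞) (e : Coframe P) {i : ι} {x : X}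
    (hx : x ∈ P.U i) (ξ : VF d X) (a b : Fin (d + 1)) :
    ContMDiffAt (𝓡 (d + 1)) 𝓘(ℝ, ℝ) ∞ (fun y => nablaMat D e i ξ y a b) x := by
  have h := (hD.contMDiff.contMDiff (σ := ξ) ξ.contMDiff.contMDiffOn x trivial).contMDiffAt
    Filter.univ_mem
  have h1 : VFSmoothAt (fun y => D ξ y (e.frame i b y)) x :=
    ContMDiffAt.clm_bundle_apply (b := id) h (e.vfSmoothAt_frame hx b)
  exact contMDiffAt_pi_space.1 ((e.smoothFormAt hx).apply h1) a

theorem LorentzConnection.eval_add (Ω : LorentzConnection P) (i : ι) (x : X)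
    (v w : TangentSpace (𝓡 (d + 1)) x) : Ω.eval i x (v + w) = Ω.eval i x v + Ω.eval i x w := by
  ext a b; simp [eval]

theorem LorentzConnection.eval_smul (Ω : LorentzConnection P) (i : ι) (x : X) (c : ℝ)
    (v : TangentSpace (𝓡 (d + 1)) x) : Ω.eval i x (c • v) = c • Ω.eval i x v := by
  ext a b; simp [eval]

/-- The Kosmann Lie derivative, `B_ξ = ω(ξ) - (∇ξ)_{𝔰𝔬(1,d)}`. -/
def kosmann (Ω : LorentzConnection P) {D : AffineConnection d X}
    (hD : CovariantDerivative.ContMDiffCovariantDerivative D ∞) (e : Coframe P) :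
    CovariantLie P where
  B i :=
    { toFun := fun ξ x => Ω.eval i x (ξ x) - soPart (nablaMat D e i ξ x)
      map_add' := fun ξ ξ' => by
        funext x
        have h : nablaMat D e i (ξ + ξ' : VF d X) x = nablaMat D e i ξ x + nablaMat D e i ξ' x := by
          ext a b
          have h1 := D.isCovariantDerivativeOnUniv.add (VF.vfSmoothAt ξ x).vfDiffAt
            (VF.vfSmoothAt ξ' x).vfDiffAt
          simp [nablaMat, h1]
        simp only [Pi.add_apply, h, soPart_add]
        rw [ContMDiffSection.coe_add, Pi.add_apply, Ω.eval_add]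
        abel
      map_smul' := fun c ξ => by
        funext x
        have h : nablaMat D e i (c • ξ : VF d X) x = c • nablaMat D e i ξ x := by
          ext a b
          have h1 := D.isCovariantDerivativeOnUniv.smul_const c (VF.vfSmoothAt ξ x).vfDiffAt
          simp [nablaMat, h1]
        simp only [Pi.smul_apply, h, soPart_smul, RingHom.id_apply]
        rw [ContMDiffSection.coe_smul, Pi.smul_apply, Ω.eval_smul, smul_sub] }
  smooth i ξ a b x hx := by
    refine ContMDiffAt.contMDiffWithinAt (ContMDiffAt.sub ?_
      (contMDiffAt_soPart (contMDiffAt_nablaMat hD e hx ξ) a b))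
    exact ((smoothFormOn_iff (P.isOpen i)).1 (Ω.smooth i a b) x hx).apply (VF.vfSmoothAt ξ x)
  mem i ξ x hx := (so d).sub_mem (Ω.mem i x hx _) (soPart_mem _)
  patch i j ξ x hx := by
    have h := Ω.patch i j x hx (ξ x)
    have h1 : soPart (nablaMat D e j ξ x) =
        P.γ j i x * soPart (nablaMat D e i ξ x) * P.γ i j x := by
      rw [nablaMat_patch D e hx, soPart_conj (P.γ_mem i j x hx) (P.γ_mem j i x hx.symm)
        (LorentzBundle.γ_mul_γ hx)]
    change Ω.eval j x (ξ x) - _ = P.γ j i x * (Ω.eval i x (ξ x) - _) * P.γ i j x + _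
    change Ω.eval j x (ξ x) = P.γ j i x * Ω.eval i x (ξ x) * P.γ i j x + _ at h
    -- The inhomogeneous term comes entirely from `ω(ξ)`.
    rw [h1, h, mul_sub, sub_mul]
    abel

/-- The Lie derivative of the coframe through the Levi-Civita connections. -/
theorem lieForm_eq {Ω : LorentzConnection P} {D : AffineConnection d X} {e : Coframe P}
    (hΩ : Ω.IsLeviCivita e) (hD : IsAffineLeviCivita D e) {i : ι} {x : X} (hx : x ∈ P.U i)
    {ξ V : ∀ x : X, TangentSpace (𝓡 (d + 1)) x} (hξ : VFDiffAt ξ x) (hV : VFDiffAt V x) :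
    lieForm ξ (e.toForm i) V x =
      e.form i x (D ξ x (V x)) - Ω.eval i x (ξ x) *ᵥ e.form i x (V x) := by
  have h := hΩ i x hx ξ V hξ hV
  unfold LorentzConnection.torsion at h
  rw [hD.eq_dCov hΩ hx hξ, ContinuousLinearEquiv.apply_symm_apply]
  have hc : (fun y => e.toForm i y (ξ y)) = e.contract i ξ := rfl
  simp only [lieForm, LorentzConnection.dCov, hc]
  -- Zero torsion gives `de(ξ, V) = ω(V) e(ξ) - ω(ξ) e(V)`; its first term completes `d(e(ξ))(V)` to
  -- `d^ω(e(ξ))(V)`.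
  rw [← sub_eq_zero, ← h]
  simp only [Coframe.contract]
  abel

/-- The `ω(ξ)` in `B_ξ` cancels the one in `L_ξ e`, leaving `∇ξ` minus its `𝔰𝔬(1,d)` part. -/
theorem isKosmann_kosmann {Ω : LorentzConnection P} {D : AffineConnection d X} {e : Coframe P}
    (hΩ : Ω.IsLeviCivita e) (hD : IsAffineLeviCivita D e)
    (hDs : CovariantDerivative.ContMDiffCovariantDerivative D ∞) :
    (kosmann Ω hDs e).IsKosmann e := by
  intro ξ i x hx V W hV hW
  have hξ := (VF.vfSmoothAt ξ x).vfDiffAt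
  have h : (kosmann Ω hDs e).onCoframe e i ξ V x = nablaMat D e i ξ x *ᵥ e.form i x (V x)
      - soPart (nablaMat D e i ξ x) *ᵥ e.form i x (V x) := by
    rw [nablaMat_mulVec]
    unfold CovariantLie.onCoframe
    rw [lieForm_eq hΩ hD hx hξ hV]
    change _ + (Ω.eval i x (ξ x) - soPart (nablaMat D e i ξ x)) *ᵥ _ = _
    rw [Matrix.sub_mulVec]
    abel
  rw [h, two_mul_eta_sub_soPart, lieMetric_eq hD hξ hV hW, e.metric_eq hx, e.metric_eq hx,
    nablaMat_mulVec, nablaMat_mulVec]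

end ExistsKosmann

end KosmannLie

end

open KosmannLie
theorem mainTheorem7 {d : ℕ} {X : Type*} [TopologicalSpace X] [T2Space X] [SigmaCompactSpace X]
    [ChartedSpace (EuclideanSpace ℝ (Fin (d + 1))) X] [IsManifold (𝓡 (d + 1)) ∞ X]
    {ι : Type*} (P : LorentzBundle d X ι) (e : Coframe P) :
    (∃ Ω : LorentzConnection P, Ω.IsLeviCivita e) ∧
    (∃ K : CovariantLie P, K.IsKosmann e) ∧
    (∃ D : AffineConnection d X, IsAffineLeviCivita D e ∧ CovariantDerivative.ContMDiffCovariantDerivative D ∞) ∧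
    ∀ (Ω : LorentzConnection P) (K : CovariantLie P) (D : AffineConnection d X),
      Ω.IsLeviCivita e → K.IsKosmann e → IsAffineLeviCivita D e →
      (∀ (ξ : ∀ x : X, TangentSpace (𝓡 (d + 1)) x) (i : ι), ∀ x ∈ P.U i, VFDiffAt ξ x →
        ∀ v : TangentSpace (𝓡 (d + 1)) x,
          D ξ x v = (e.form i x).symm (Ω.dCov i (e.contract i ξ) x v)) ∧
      ∀ ξ : VF d X,
        (K.VanishesOnCoframe e ξ ↔
          ∀ i, ∀ x ∈ P.U i, symPart (Ω.dCovComp e i ξ x) = 0) ∧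
        ((∀ i, ∀ x ∈ P.U i, symPart (Ω.dCovComp e i ξ x) = 0) ↔
          ∀ i, ∀ x ∈ P.U i, symPart (nablaComp D e i ξ x) = 0) ∧
        ((∀ i, ∀ x ∈ P.U i, symPart (nablaComp D e i ξ x) = 0) ↔
          e.LieMetricVanishes ξ) := by
  have hΩ₀ := e.isLeviCivita_leviCivita
  refine ⟨⟨e.leviCivita, hΩ₀⟩,
    ⟨_, isKosmann_kosmann hΩ₀ hΩ₀.isAffineLeviCivita_affine hΩ₀.contMDiff_affine⟩,
    ⟨_, hΩ₀.isAffineLeviCivita_affine, hΩ₀.contMDiff_affine⟩, ?_⟩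
  intro Ω K D hΩ hK hD
  refine ⟨fun ξ i x hx hξ v => hD.eq_dCov hΩ hx hξ v, fun ξ => ?_⟩
  have h23 : (∀ i, ∀ x ∈ P.U i, symPart (Ω.dCovComp e i ξ x) = 0) ↔
      ∀ i, ∀ x ∈ P.U i, symPart (nablaComp D e i ξ x) = 0 :=
    forall_congr' fun i => forall₂_congr fun x hx => by
      rw [symPart_dCovComp hD hΩ hx (VF.vfSmoothAt ξ x).vfDiffAt]
  have h34 := killing_iff hD ξ
  exact ⟨(kosmann_vanishes_iff hK ξ).trans (h34.symm.trans h23.symm), h23, h34⟩
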